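/- **Coarse upper bound for the ICL risk.** Let $d,M\ge 1$. *Pretraining model:* a task $(\mu,w)\in\mathbb R^d\times\mathbb R^d$ is drawn from the prior $\sum_{m=1}^M\pi_m\,\mathcal N(\mu_m,\sigma_\mu^2 I)\otimes\mathcal N(w_m,\sigma_w^2 I)$, where $\pi_m>0$, $\sum_m\pi_m=1$, $\|\mu_m\|=\|w_m\|=1$ and $\sigma_\mu,\sigma_w>0$. Given the task, the samples $(x_i,y_i)$, $i=1,\dots,K$, are i.i.d. with $x_i\sim\mathcal N(\mu,\sigma_x^2I)$ and $y_i\mid x_i\sim\mathcal N(\langle w,x_i\rangle,\sigma_y^2)$, where $\sigma_x,\sigma_y>0$. Put $\mathcal S_k\oplus x_{k+1}=(x_1,y_1,\dots,x_k,y_k,x_{k+1})$ and $\delta_w=\sigma_w^2/\sigma_y^2$. A predictor $\mathcal F=(\mathcal F_0,\dots,\mathcal F_{K-1})$, with $\mathcal F_k$ a real function of $\mathcal S_k\oplus x_{k+1}$, has *optimal pretraining risk* if it is measurable and minimizes $\mathbb E\big[\frac1K\sum_{k=0}^{K-1}(\mathcal F_k(\mathcal S_k\oplus x_{k+1})-y_{k+1})^2\big]$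 among all measurable predictors. The *Bayes predictor* maps each $\mathcal S_k\oplus x_{k+1}$ to the mean of $\langle w,x_{k+1}\rangle$ under the posterior of $(\mu,w)$ given by Bayes' formula, i.e. the prior reweighted by the Gaussian likelihood of $\mathcal S_k\oplus x_{k+1}$ and normalized. *In-context examples:* let $\|\mu^*\|=\|w^*\|=1$ and $\tau_x>0$, let $x_1,\dots,x_{k+1}$ be i.i.d. $\mathcal N(\mu^*,\tau_x^2I)$ and $y_i=\langle x_i,w^*\rangle$ (no label noise), and let $\mathcal L_k^*=(\mathcal F_k(\mathcal S_k\oplus x_{k+1})-\langle x_{k+1},w^*\rangle)^2$. Then the Bayes predictor is continuous and has optimal pretraining risk for every $K$. Moreover, for every $\delta>0$ there are $C$ and $k_0$ (depending on the pretraining model, $\mu^*,w^*,\tau_x,\delta$, but not on $K$ or $\mathcal F$) such that for all $K>k\ge k_0$ and every continuous predictor $\mathcal F$ with optimal pretraining risk (in particular for the Bayes predictor), $$\mathbb E_{\mathcal S_k\oplus x_{k+1}}[\mathcal L_k^*]<\frac{4(1+d\tau_x^2)}{\tau_x^4\,\delta_w^2\,k^2}+C\,k^{\delta-5/2}.$$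 Thus the ICL risk decays at the rate $1/k^2$ as $k\to\infty$. -/

import Mathlib

open MeasureTheory ProbabilityTheory
open scoped ENNReal NNReal

noncomputable section

/-- Tokens `x` and task parameters `μ`, `w` live in Euclidean `d`-space. -/
abbrev Vec (d : ℕ) : Type := EuclideanSpace ℝ (Fin d)

/-- A sequence `x₁, y₁, …, x_k, y_k, x_{k+1}`: `k` labeled samples and one unlabeled input. -/
abbrev Prompt (d k : ℕ) : Type := (Fin k → Vec d × ℝ) × Vec d

/-- A next-token predictor for sequences of `K` labeled samples: one predictor for each
number `k < K` of preceding labeled samples. -/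
abbrev Predictor (d K : ℕ) : Type := (k : Fin K) → Prompt d k → ℝ

/-- The isotropic Gaussian law `N(c, s² I)`. -/
def isoGaussian {d : ℕ} (c : Vec d) (s : ℝ) : Measure (Vec d) :=
  multivariateGaussian c (s ^ 2 • (1 : Matrix (Fin d) (Fin d) ℝ))

/-- The density of `N(c, s² I)` at `x`. -/
def isoGaussianDensity {d : ℕ} (c : Vec d) (s : ℝ) (x : Vec d) : ℝ :=
  (Real.sqrt (2 * Real.pi * s ^ 2))⁻¹ ^ d * Real.exp (-‖x - c‖ ^ 2 / (2 * s ^ 2))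

/-- Parameters of the pretraining data model: a Gaussian mixture prior with `M` components over
tasks `(μ, w)`, Gaussian inputs and noisy linear labels. -/
structure PretrainModel (d M : ℕ) where
  /-- mixture weights -/
  weight : Fin M → ℝ
  /-- centers `μ_m` -/
  muCenter : Fin M → Vec d
  /-- centers `w_m` -/
  wCenter : Fin M → Vec d
  sigmaMu : ℝ
  sigmaW : ℝ
  sigmaX : ℝ
  sigmaY : ℝ
  weight_pos : ∀ m, 0 < weight m
  weight_sum : ∑ m, weight m = 1
  norm_muCenter : ∀ m, ‖muCenter m‖ = 1
  norm_wCenter : ∀ m, ‖wCenter m‖ = 1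
  sigmaMu_pos : 0 < sigmaMu
  sigmaW_pos : 0 < sigmaW
  sigmaX_pos : 0 < sigmaX
  sigmaY_pos : 0 < sigmaY

namespace PretrainModel

variable {d M : ℕ} (P : PretrainModel d M)

/-- `δ_w = σ_w² / σ_y²`. -/
def deltaW : ℝ := P.sigmaW ^ 2 / P.sigmaY ^ 2

/-- The task prior: the law of `(μ, w)`. -/
def prior : Measure (Vec d × Vec d) :=
  ∑ m, ENNReal.ofReal (P.weight m) •
    (isoGaussian (P.muCenter m) P.sigmaMu).prod (isoGaussian (P.wCenter m) P.sigmaW)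

/-- The law of one labeled sample `(x, y)` of the task `t = (μ, w)`: `x ∼ N(μ, σ_x² I)` and
`y = ⟨w, x⟩ + e` with `e ∼ N(0, σ_y²)` independent of `x`, so `y | x ∼ N(⟨w, x⟩, σ_y²)`. -/
def sampleLaw (t : Vec d × Vec d) : Measure (Vec d × ℝ) :=
  ((isoGaussian t.1 P.sigmaX).prod (gaussianReal 0 ⟨P.sigmaY ^ 2, sq_nonneg _⟩)).map
    (fun p => (p.1, inner ℝ t.2 p.1 + p.2))

/-- The pretraining risk `E[(1/K) ∑_{k<K} (F_k(S_k ⊕ x_{k+1}) - y_{k+1})²]`, where a task is drawn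
from the prior and then `K` i.i.d. samples are drawn from the task. -/
def pretrainRisk (K : ℕ) (F : Predictor d K) : ℝ≥0∞ :=
  ∫⁻ t, ∫⁻ S : Fin K → Vec d × ℝ,
    ENNReal.ofReal ((1 / (K : ℝ)) *
      ∑ k : Fin K, (F k (fun i => S (Fin.castLE k.isLt.le i), (S k).1) - (S k).2) ^ 2)
    ∂(Measure.pi fun _ => P.sampleLaw t) ∂P.prior

/-- `F` attains the optimal pretraining risk among all measurable predictors. -/
def IsOptimal (K : ℕ) (F : Predictor d K) : Prop :=
  (∀ k, Measurable (F k)) ∧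
    ∀ G : Predictor d K, (∀ k, Measurable (G k)) → P.pretrainRisk K F ≤ P.pretrainRisk K G

/-- The likelihood of the observation `S_k ⊕ x_{k+1}` under the task `t = (μ, w)`. -/
def likelihood {k : ℕ} (q : Prompt d k) (t : Vec d × Vec d) : ℝ :=
  (∏ i, isoGaussianDensity t.1 P.sigmaX (q.1 i).1 *
      gaussianPDFReal (inner ℝ t.2 (q.1 i).1) ⟨P.sigmaY ^ 2, sq_nonneg _⟩ (q.1 i).2) *
    isoGaussianDensity t.1 P.sigmaX q.2

/-- The Bayes predictor: the mean of `E[y_{k+1} | (μ, w), x_{k+1}] = ⟨w, x_{k+1}⟩` under the task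
posterior, whose density with respect to the prior is proportional to the likelihood. -/
def bayesPredictor (k : ℕ) (q : Prompt d k) : ℝ :=
  (∫ t, P.likelihood q t * inner ℝ t.2 q.2 ∂P.prior) / ∫ t, P.likelihood q t ∂P.prior

end PretrainModel

/-- The in-context-learning risk `E[(f(S_k ⊕ x_{k+1}) - ⟨x_{k+1}, w*⟩)²]` of `f` on `k` in-context
examples, where `x₁, …, x_{k+1}` are i.i.d. `N(μ*, τ² I)` and `y_i = ⟨x_i, w*⟩` without noise. -/
def iclRisk {d : ℕ} (muStar wStar : Vec d) (tau : ℝ) (k : ℕ) (f : Prompt d k → ℝ) : ℝ≥0∞ :=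
  ∫⁻ x : Fin (k + 1) → Vec d,
    ENNReal.ofReal
      ((f (fun i => (x i.castSucc, inner ℝ (x i.castSucc) wStar), x (Fin.last k))
        - inner ℝ (x (Fin.last k)) wStar) ^ 2)
    ∂(Measure.pi fun _ => isoGaussian muStar tau)

end

/-! The proof identifies every admissible predictor with the Bayes predictor, computes the posterior
mean exactly on noiseless data, and controls the Gram matrix of the inputs by a Chernoff bound.

Optimality. Label noise is independent of the past, so the pretraining risk is, up to a positive
factor and a constant, a sum of separate estimation risks, one per position. For a fixed prompt the
bias-variance identity gives (`estimationRisk_eq`): risk of `f` = risk of the Bayes predictor + ∫ Z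
(f - Bayes)², with Z > 0 the marginal density of the prompt. Hence the Bayes predictor is optimal,
and every optimal predictor agrees with it Lebesgue-almost everywhere. Noiseless prompts form a null
set as soon as k ≥ 1, so this alone says nothing about them; continuity upgrades it to equality
everywhere (`eq_bayesPredictor_of_isOptimal`).

Posterior mean. Within component m the likelihood splits into a μ-factor and a w-factor, and the
posterior of w is Gaussian, centered at w* + v_m with (I + δ_w ∑ x_i x_iᵀ) v_m = w_m - w*. If the
Gram matrix is at least l·I, then ‖v_m‖ ≤ 2 / (1 + δ_w l). The prediction error is a convex
combination of the ⟨v_m, x_{k+1}⟩, so the posterior weights of the components are irrelevant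
(`sq_bayesPredictor_sub_le`).

Concentration. If each entry of the Gram matrix is within t of its mean, then l = kτ² - d t is
admissible. Otherwise l = 0 still bounds the squared error by 4‖x_{k+1}‖², and a Chernoff bound
makes this case negligible. With t = k^(1/2+η) the main term is 4(1 + dτ²) / (δ_w l)², where 4
bounds ‖w_m - w*‖² and 1 + dτ² = E‖x_{k+1}‖²; replacing l by kτ² costs O(k^(η-5/2)). -/

noncomputable section

/-! ### Product measures: Tonelli, densities, i.i.d. subfamilies -/

/-- Tonelli for a product of functions of the single coordinates. -/
theorem lintegral_pi_prod {n : ℕ} {E : Type*} [MeasurableSpace E] (μ : Fin n → Measure E)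
    [∀ i, SigmaFinite (μ i)] (f : Fin n → E → ℝ≥0∞) (hf : ∀ i, Measurable (f i)) :
    ∫⁻ x, ∏ i, f i (x i) ∂(Measure.pi μ) = ∏ i, ∫⁻ x, f i x ∂(μ i) := by
  induction n with
  | zero => simp
  | succ n ih =>
    rw [← ((measurePreserving_piFinSuccAbove μ 0).symm).lintegral_comp_emb
      (MeasurableEquiv.measurableEmbedding _)]
    simp_rw [MeasurableEquiv.piFinSuccAbove_symm_apply, Fin.insertNthEquiv,
      Fin.prod_univ_succ, Fin.insertNth_zero]
    simp only [Fin.zero_succAbove, Equiv.coe_fn_mk, Fin.cons_zero, Fin.cons_succ]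
    rw [← ih (fun i => μ i.succ) (fun i => f i.succ) (fun i => hf _)]
    exact lintegral_prod_mul (f := f 0)
      (g := fun y : Fin n → E => ∏ i : Fin n, f i.succ (y i)) (hf 0).aemeasurable
      (Finset.measurable_prod _ fun i _ =>
        (hf i.succ).comp (measurable_pi_apply i)).aemeasurable

theorem pi_withDensity {n : ℕ} {E : Type*} [MeasurableSpace E] (μ : Fin n → Measure E)
    [∀ i, SigmaFinite (μ i)] (f : Fin n → E → ℝ≥0∞) (hf : ∀ i, Measurable (f i))
    [∀ i, SigmaFinite ((μ i).withDensity (f i))] :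
    Measure.pi (fun i => (μ i).withDensity (f i))
      = (Measure.pi μ).withDensity (fun x => ∏ i, f i (x i)) := by
  refine Measure.pi_eq fun s hs => ?_
  rw [withDensity_apply _ (MeasurableSet.univ_pi hs), Measure.restrict_pi_pi,
    lintegral_pi_prod _ _ hf]
  exact Finset.prod_congr rfl fun i _ => (withDensity_apply _ (hs i)).symm

theorem map_withDensity_comp {α β : Type*} [MeasurableSpace α] [MeasurableSpace β]
    {μ : Measure α} {ν : Measure β} {e : α → β} (he : MeasurePreserving e μ ν)
    {g : β → ℝ≥0∞} (hg : Measurable g) :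
    (μ.withDensity (g ∘ e)).map e = ν.withDensity g := by
  ext s hs
  rw [Measure.map_apply he.measurable hs, withDensity_apply _ (he.measurable hs),
    withDensity_apply _ hs, ← he.setLIntegral_comp_preimage hs hg]
  rfl

/-- Selecting coordinates of an i.i.d. family along an injection gives an i.i.d. family. -/
theorem measurePreserving_comp_injective {ι κ E : Type*} [Fintype ι] [Fintype κ]
    [MeasurableSpace E] (μ : Measure E) [IsProbabilityMeasure μ] {e : ι → κ}
    (he : Function.Injective e) :
    MeasurePreserving (fun (S : κ → E) i => S (e i)) (Measure.pi fun _ => μ)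
      (Measure.pi fun _ => μ) := by
  classical
  refine ⟨by fun_prop, (Measure.pi_eq fun s hs => ?_).symm⟩
  rw [Measure.map_apply (by fun_prop) (MeasurableSet.univ_pi hs)]
  have hpre : (fun (S : κ → E) i => S (e i)) ⁻¹' Set.univ.pi s
      = Set.univ.pi (Function.extend e s fun _ => Set.univ) := by
    ext S
    simp only [Set.mem_preimage, Set.mem_pi, Set.mem_univ, true_implies]
    constructor
    · intro h j
      by_cases hj : ∃ i, e i = j
      · obtain ⟨i, rfl⟩ := hj
        rw [he.extend_apply]; exact h i
      · rw [Function.extend_apply' _ _ _ hj]; trivial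
    · intro h i
      simpa [he.extend_apply] using h (e i)
  rw [hpre, Measure.pi_pi, ← Finset.prod_subset (Finset.subset_univ (Finset.univ.image e)),
    Finset.prod_image he.injOn]
  · simp [he.extend_apply]
  · intro j _ hj
    rw [Function.extend_apply' _ _ _ (by simpa using hj)]
    exact measure_univ

/-- The square of a real number as a nonnegative real. -/
def sqNNReal (s : ℝ) : ℝ≥0 := ⟨s ^ 2, sq_nonneg s⟩

@[simp]
theorem coe_sqNNReal (s : ℝ) : (sqNNReal s : ℝ) = s ^ 2 := rfl

theorem sqNNReal_ne_zero {s : ℝ} (hs : 0 < s) : sqNNReal s ≠ 0 := by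
  intro h
  have := congrArg NNReal.toReal h
  simp at this
  exact hs.ne' this

/-! ### Isotropic Gaussians: density and second moments -/

section IsoGaussian

variable {d : ℕ}

instance isGaussian_isoGaussian (c : Vec d) (s : ℝ) : IsGaussian (isoGaussian c s) :=
  isGaussian_multivariateGaussian

theorem posSemidef_sq_smul_one (s : ℝ) :
    (s ^ 2 • (1 : Matrix (Fin d) (Fin d) ℝ)).PosSemidef :=
  Matrix.PosSemidef.one.smul (sq_nonneg s)

/-- The characteristic functions agree. This reduces the density of `isoGaussian` to the
one-dimensional Gaussian density. -/
theorem isoGaussian_eq_map_pi (c : Vec d) (s : ℝ) :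
    isoGaussian c s
      = (Measure.pi fun i => gaussianReal (c i) (sqNNReal s)).map (WithLp.toLp 2) := by
  apply Measure.ext_of_charFun (E := Vec d)
  ext t
  rw [isoGaussian, charFun_multivariateGaussian (posSemidef_sq_smul_one s), charFun_pi]
  simp_rw [charFun_gaussianReal, ← Complex.exp_sum]
  congr 1
  simp [Finset.sum_sub_distrib, PiLp.inner_apply, Matrix.smul_mulVec, dotProduct, Finset.sum_mul,
    Finset.sum_div]
  refine congrArg₂ _ (Finset.sum_congr rfl fun i _ => ?_) (Finset.sum_congr rfl fun i _ => ?_) <;>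
    ring

theorem isoGaussianDensity_pos (c : Vec d) {s : ℝ} (hs : 0 < s) (x : Vec d) :
    0 < isoGaussianDensity c s x := by
  unfold isoGaussianDensity
  have := Real.pi_pos
  positivity

theorem continuous_isoGaussianDensity (s : ℝ) :
    Continuous fun p : Vec d × Vec d => isoGaussianDensity p.1 s p.2 := by
  unfold isoGaussianDensity
  fun_prop

theorem isoGaussianDensity_le (c : Vec d) (s : ℝ) (x : Vec d) :
    isoGaussianDensity c s x ≤ (Real.sqrt (2 * Real.pi * s ^ 2))⁻¹ ^ d := by
  unfold isoGaussianDensity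
  refine mul_le_of_le_one_right (by positivity) (Real.exp_le_one_iff.2 ?_)
  rw [neg_div]
  exact neg_nonpos.2 (by positivity)

theorem isoGaussian_eq_withDensity (c : Vec d) {s : ℝ} (hs : 0 < s) :
    isoGaussian c s
      = volume.withDensity fun x => ENNReal.ofReal (isoGaussianDensity c s x) := by
  have hv := sqNNReal_ne_zero hs
  rw [isoGaussian_eq_map_pi]
  have hpi : (Measure.pi fun i => gaussianReal (c i) (sqNNReal s))
      = (volume : Measure (Fin d → ℝ)).withDensity
        ((fun x : Vec d => ENNReal.ofReal (isoGaussianDensity c s x)) ∘ WithLp.toLp 2) := by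
    simp_rw [gaussianReal_of_var_ne_zero _ hv]
    have : ∀ i, SigmaFinite
        (volume.withDensity (gaussianPDF (c i) (sqNNReal s))) := fun i => by
      rw [← gaussianReal_of_var_ne_zero _ hv]; infer_instance
    rw [pi_withDensity _ _ fun i => measurable_gaussianPDF _ _]
    congr 1
    ext x
    simp only [gaussianPDF, Function.comp]
    rw [← ENNReal.ofReal_prod_of_nonneg fun i _ => gaussianPDFReal_nonneg _ _ _]
    congr 1
    simp only [gaussianPDFReal, isoGaussianDensity, Finset.prod_mul_distrib, ← Real.exp_sum,
      coe_sqNNReal]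
    rw [EuclideanSpace.real_norm_sq_eq]
    simp [Finset.sum_div, neg_div]
  rw [hpi, map_withDensity_comp (PiLp.volume_preserving_toLp (Fin d))]
  unfold isoGaussianDensity
  fun_prop

theorem integral_coord_mul_coord_isoGaussian (c : Vec d) (s : ℝ) (a b : Fin d) :
    ∫ x, x a * x b ∂(isoGaussian c s) = c a * c b + if a = b then s ^ 2 else 0 := by
  have hL (a : Fin d) : MemLp (fun x : Vec d => x a) 2 (isoGaussian c s) := by
    have := (IsGaussian.memLp_two_id (μ := isoGaussian c s)).continuousLinearMap_comp
      (EuclideanSpace.proj (𝕜 := ℝ) a)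
    exact this
  have hm (a : Fin d) : ∫ x, x a ∂(isoGaussian c s) = c a := by
    have := (EuclideanSpace.proj (𝕜 := ℝ) a : Vec d →L[ℝ] ℝ).integral_comp_comm
      (IsGaussian.integrable_id (μ := isoGaussian c s))
    simp only [id] at this
    rw [show ∫ x, x ∂(isoGaussian c s) = c from integral_id_multivariateGaussian] at this
    exact this
  have hcov := covariance_eval_multivariateGaussian (μ := c)
    (posSemidef_sq_smul_one (d := d) s) a b
  change cov[fun x => x a, fun x => x b; isoGaussian c s] = _ at hcov
  rw [covariance_eq_sub (hL a) (hL b), hm, hm] at hcov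
  simp only [Pi.mul_apply, Matrix.smul_apply, Matrix.one_apply, smul_eq_mul, mul_ite, mul_one,
    mul_zero] at hcov
  linarith

theorem lintegral_norm_sq_isoGaussian (c : Vec d) (s : ℝ) :
    ∫⁻ x, ENNReal.ofReal (‖x‖ ^ 2) ∂(isoGaussian c s)
      = ENNReal.ofReal (‖c‖ ^ 2 + d * s ^ 2) := by
  have hi : Integrable (fun x : Vec d => ‖x‖ ^ 2) (isoGaussian c s) :=
    (IsGaussian.memLp_two_id (μ := isoGaussian c s)).integrable_norm_pow (by norm_num)
  rw [← ofReal_integral_eq_lintegral_ofReal hi (by filter_upwards with x; positivity)]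
  congr 1
  simp_rw [EuclideanSpace.real_norm_sq_eq, pow_two]
  rw [integral_finsetSum]
  · simp [integral_coord_mul_coord_isoGaussian, Finset.sum_add_distrib, pow_two]
  · intro a _
    have := (IsGaussian.memLp_two_id (μ := isoGaussian c s)).continuousLinearMap_comp
      (EuclideanSpace.proj (𝕜 := ℝ) a)
    exact MemLp.integrable_mul this this

end IsoGaussian

/-! ### Two square expansions: label noise and bias-variance -/

theorem lintegral_sub_sq_gaussianReal (a s : ℝ) :
    ∫⁻ e, ENNReal.ofReal ((a - e) ^ 2) ∂(gaussianReal 0 (sqNNReal s))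
      = ENNReal.ofReal (a ^ 2) + ENNReal.ofReal (s ^ 2) := by
  have hL : MemLp (id : ℝ → ℝ) 2 (gaussianReal 0 (sqNNReal s)) := IsGaussian.memLp_two_id
  have hsq : Integrable (fun e : ℝ => e ^ 2) (gaussianReal 0 (sqNNReal s)) := hL.integrable_sq
  have h1 : Integrable (fun e : ℝ => e) (gaussianReal 0 (sqNNReal s)) := hL.integrable (by norm_num)
  have hm : ∫ e, e ∂(gaussianReal 0 (sqNNReal s)) = 0 := integral_id_gaussianReal
  have hv : ∫ e, e ^ 2 ∂(gaussianReal 0 (sqNNReal s)) = s ^ 2 := by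
    have := variance_eq_sub hL
    rw [variance_id_gaussianReal] at this
    simpa [hm] using this.symm
  have hexp : (fun e : ℝ => (a - e) ^ 2) = fun e => (a ^ 2 - 2 * a * e) + e ^ 2 := by
    ext e; ring
  have hi1 : Integrable (fun e : ℝ => a ^ 2 - 2 * a * e) (gaussianReal 0 (sqNNReal s)) :=
    (integrable_const _).sub (h1.const_mul _)
  rw [← ofReal_integral_eq_lintegral_ofReal, ← ENNReal.ofReal_add (sq_nonneg _) (sq_nonneg _)]
  · rw [hexp, integral_add hi1 hsq,
      integral_sub (integrable_const _) (h1.const_mul _), integral_const_mul, hm, hv]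
    simp
  · rw [hexp]; exact hi1.add hsq
  · exact .of_forall fun e => sq_nonneg _

/-- Bias-variance decomposition with respect to a weighted measure. -/
theorem integral_mul_sub_sq {α : Type*} [MeasurableSpace α] {ν : Measure α} {L g : α → ℝ}
    (hL : Integrable L ν) (hg : Integrable (fun t => L t * g t) ν)
    (hg2 : Integrable (fun t => L t * g t ^ 2) ν) (hZ : ∫ t, L t ∂ν ≠ 0) (a : ℝ) :
    ∫ t, L t * (a - g t) ^ 2 ∂ν
      = (∫ t, L t ∂ν) * (a - (∫ t, L t * g t ∂ν) / ∫ t, L t ∂ν) ^ 2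
        + ∫ t, L t * ((∫ t, L t * g t ∂ν) / (∫ t, L t ∂ν) - g t) ^ 2 ∂ν := by
  have hsub (a : ℝ) : Integrable (fun t => a ^ 2 * L t - 2 * a * (L t * g t)) ν :=
    (hL.const_mul _).sub (hg.const_mul _)
  have key (a : ℝ) : ∫ t, L t * (a - g t) ^ 2 ∂ν
      = a ^ 2 * (∫ t, L t ∂ν) - 2 * a * (∫ t, L t * g t ∂ν) + ∫ t, L t * g t ^ 2 ∂ν := by
    rw [← integral_const_mul, ← integral_const_mul,
      ← integral_sub (hL.const_mul _) (hg.const_mul _),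
      ← integral_add (hsub a) hg2]
    congr 1
    ext t
    ring
  rw [key, key]
  field_simp
  ring

/-! ### The law of a prompt given the task, and the conditional loss -/

namespace PretrainModel

variable {d M : ℕ} (P : PretrainModel d M)

/-- The law of the observation `S_k ⊕ x_{k+1}` given the task. -/
def promptLaw (k : ℕ) (t : Vec d × Vec d) : Measure (Prompt d k) :=
  (Measure.pi fun _ => P.sampleLaw t).prod (isoGaussian t.1 P.sigmaX)

theorem sampleLaw_eq_map (t : Vec d × Vec d) : P.sampleLaw t =
    ((isoGaussian t.1 P.sigmaX).prod (gaussianReal 0 (sqNNReal P.sigmaY))).map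
      (fun p => (p.1, inner ℝ t.2 p.1 + p.2)) := rfl

theorem likelihood_eq {k : ℕ} (q : Prompt d k) (t : Vec d × Vec d) : P.likelihood q t =
    (∏ i, isoGaussianDensity t.1 P.sigmaX (q.1 i).1 *
      gaussianPDFReal (inner ℝ t.2 (q.1 i).1) (sqNNReal P.sigmaY) (q.1 i).2) *
    isoGaussianDensity t.1 P.sigmaX q.2 := rfl

instance isProbabilityMeasure_sampleLaw (t : Vec d × Vec d) :
    IsProbabilityMeasure (P.sampleLaw t) := by
  rw [sampleLaw_eq_map]
  exact Measure.isProbabilityMeasure_map (Measurable.aemeasurable (by fun_prop))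

theorem lintegral_sampleLaw (t : Vec d × Vec d) {g : Vec d × ℝ → ℝ≥0∞} (hg : Measurable g) :
    ∫⁻ z, g z ∂(P.sampleLaw t) = ∫⁻ x, ∫⁻ e, g (x, inner ℝ t.2 x + e)
      ∂(gaussianReal 0 (sqNNReal P.sigmaY)) ∂(isoGaussian t.1 P.sigmaX) := by
  rw [sampleLaw_eq_map, lintegral_map hg (by fun_prop), lintegral_prod]
  exact (hg.comp (by fun_prop)).aemeasurable

/-- The density of one labeled sample. -/
def sampleDensity (t : Vec d × Vec d) (p : Vec d × ℝ) : ℝ :=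
  isoGaussianDensity t.1 P.sigmaX p.1 * gaussianPDFReal (inner ℝ t.2 p.1) (sqNNReal P.sigmaY) p.2

theorem continuous_sampleDensity :
    Continuous fun z : (Vec d × Vec d) × (Vec d × ℝ) => P.sampleDensity z.1 z.2 := by
  unfold sampleDensity isoGaussianDensity gaussianPDFReal
  fun_prop

theorem sampleDensity_pos (t : Vec d × Vec d) (p : Vec d × ℝ) : 0 < P.sampleDensity t p :=
  mul_pos (isoGaussianDensity_pos _ P.sigmaX_pos _)
    (gaussianPDFReal_pos _ _ _ (sqNNReal_ne_zero P.sigmaY_pos))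

theorem sampleLaw_eq_withDensity (t : Vec d × Vec d) :
    P.sampleLaw t = volume.withDensity fun p => ENNReal.ofReal (P.sampleDensity t p) := by
  have hc : Measurable fun p => ENNReal.ofReal (P.sampleDensity t p) :=
    (P.continuous_sampleDensity.comp
      (continuous_const.prodMk continuous_id)).measurable.ennreal_ofReal
  have hx : Measurable fun x => ENNReal.ofReal (isoGaussianDensity t.1 P.sigmaX x) :=
    ((continuous_isoGaussianDensity P.sigmaX).comp
      (continuous_const.prodMk continuous_id)).measurable.ennreal_ofReal
  refine Measure.ext_of_lintegral _ fun g hg => ?_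
  rw [P.lintegral_sampleLaw t hg, lintegral_withDensity_eq_lintegral_mul _ hc hg,
    Measure.volume_eq_prod, lintegral_prod _ (hc.mul hg).aemeasurable,
    isoGaussian_eq_withDensity _ P.sigmaX_pos, lintegral_withDensity_eq_lintegral_mul _ hx]
  · refine lintegral_congr fun x => ?_
    have hgx : Measurable fun y => g (x, y) := hg.comp (by fun_prop)
    have h1 : ∫⁻ e, g (x, inner ℝ t.2 x + e) ∂(gaussianReal 0 (sqNNReal P.sigmaY))
        = ∫⁻ y, g (x, y) ∂(gaussianReal (inner ℝ t.2 x) (sqNNReal P.sigmaY)) := by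
      have := gaussianReal_map_const_add (μ := 0) (v := sqNNReal P.sigmaY) (inner ℝ t.2 x)
      rw [zero_add] at this
      rw [← this, lintegral_map hgx (by fun_prop)]
    rw [Pi.mul_apply, h1, gaussianReal_of_var_ne_zero _ (sqNNReal_ne_zero P.sigmaY_pos),
      lintegral_withDensity_eq_lintegral_mul _ (measurable_gaussianPDF _ _) hgx,
      ← lintegral_const_mul _ ((measurable_gaussianPDF _ _).mul hgx)]
    refine lintegral_congr fun y => ?_
    simp only [Pi.mul_apply, sampleDensity]
    rw [ENNReal.ofReal_mul (isoGaussianDensity_pos _ P.sigmaX_pos _).le, mul_assoc]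
    rfl
  · exact Measurable.lintegral_prod_right' (f := fun z : Vec d × ℝ => g (z.1, inner ℝ t.2 z.1 + z.2))
      (hg.comp (by fun_prop))

theorem likelihood_eq_prod {k : ℕ} (q : Prompt d k) (t : Vec d × Vec d) : P.likelihood q t =
    (∏ i, P.sampleDensity t (q.1 i)) * isoGaussianDensity t.1 P.sigmaX q.2 := rfl

theorem likelihood_pos {k : ℕ} (q : Prompt d k) (t : Vec d × Vec d) : 0 < P.likelihood q t :=
  mul_pos (Finset.prod_pos fun _ _ => P.sampleDensity_pos _ _)
    (isoGaussianDensity_pos _ P.sigmaX_pos _)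

/-- This ties the likelihood in Bayes' formula to the sampling law in the pretraining risk: all
tasks share Lebesgue measure as reference measure. -/
theorem promptLaw_eq_withDensity (k : ℕ) (t : Vec d × Vec d) :
    P.promptLaw k t = volume.withDensity fun q => ENNReal.ofReal (P.likelihood q t) := by
  have hc : Measurable fun p => ENNReal.ofReal (P.sampleDensity t p) :=
    (P.continuous_sampleDensity.comp
      (continuous_const.prodMk continuous_id)).measurable.ennreal_ofReal
  have hx : Measurable fun x => ENNReal.ofReal (isoGaussianDensity t.1 P.sigmaX x) :=
    ((continuous_isoGaussianDensity P.sigmaX).comp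
      (continuous_const.prodMk continuous_id)).measurable.ennreal_ofReal
  have hprob : IsProbabilityMeasure
      (volume.withDensity fun p => ENNReal.ofReal (P.sampleDensity t p)) := by
    rw [← sampleLaw_eq_withDensity]; infer_instance
  have hpi : (Measure.pi fun _ : Fin k => P.sampleLaw t)
      = volume.withDensity fun S => ∏ i, ENNReal.ofReal (P.sampleDensity t (S i)) := by
    simp_rw [sampleLaw_eq_withDensity]
    exact pi_withDensity _ _ fun _ => hc
  rw [promptLaw, hpi, isoGaussian_eq_withDensity _ P.sigmaX_pos, prod_withDensity _ hx]
  · refine congrArg _ (funext fun q => ?_)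
    rw [likelihood_eq_prod, ENNReal.ofReal_mul (Finset.prod_nonneg fun _ _ =>
      (P.sampleDensity_pos _ _).le), ENNReal.ofReal_prod_of_nonneg fun _ _ =>
      (P.sampleDensity_pos _ _).le]
  · exact Finset.measurable_prod _ fun i _ => hc.comp (measurable_pi_apply i)

/-- The bound is uniform in prompt and task, which supplies the dominating functions for
integrability under the prior and for continuity in the prompt. -/
theorem likelihood_le (k : ℕ) : ∃ c, ∀ (q : Prompt d k) t, P.likelihood q t ≤ c := by
  refine ⟨(∏ _i : Fin k, (Real.sqrt (2 * Real.pi * P.sigmaX ^ 2))⁻¹ ^ d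
    * (Real.sqrt (2 * Real.pi * P.sigmaY ^ 2))⁻¹)
    * (Real.sqrt (2 * Real.pi * P.sigmaX ^ 2))⁻¹ ^ d, fun q t => ?_⟩
  rw [likelihood_eq_prod]
  have hpos := fun x => (isoGaussianDensity_pos t.1 P.sigmaX_pos x).le
  refine mul_le_mul (Finset.prod_le_prod (fun _ _ => (P.sampleDensity_pos _ _).le) fun i _ => ?_)
    (isoGaussianDensity_le _ _ _) (hpos _) (by positivity)
  refine mul_le_mul (isoGaussianDensity_le _ _ _) ?_ (gaussianPDFReal_nonneg _ _ _) (by positivity)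
  unfold gaussianPDFReal
  refine mul_le_of_le_one_right (by positivity) (Real.exp_le_one_iff.2 ?_)
  rw [neg_div]
  exact neg_nonpos.2 (by positivity)

/-- The expected squared loss is the error in estimating `⟨w, x_{k+1}⟩` plus the label noise. -/
theorem lintegral_sq_loss {K : ℕ} (k : Fin K) {f : Prompt d k → ℝ} (hf : Measurable f)
    (t : Vec d × Vec d) :
    ∫⁻ S : Fin K → Vec d × ℝ,
        ENNReal.ofReal ((f (fun i => S (Fin.castLE k.isLt.le i), (S k).1) - (S k).2) ^ 2)
        ∂(Measure.pi fun _ => P.sampleLaw t)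
      = (∫⁻ q, ENNReal.ofReal ((f q - inner ℝ t.2 q.2) ^ 2) ∂(P.promptLaw k t))
        + ENNReal.ofReal (P.sigmaY ^ 2) := by
  -- Keep the first k + 1 of the K samples, split off the last of them, and swap it into second
  -- place as the query with its label.
  have h1 := measurePreserving_comp_injective (P.sampleLaw t)
    (Fin.castLE_injective (Nat.succ_le_of_lt k.isLt))
  have h2 := (measurePreserving_piFinSuccAbove (fun _ : Fin (k + 1) => P.sampleLaw t)
    (Fin.last k)).comp h1
  have h3 := Measure.measurePreserving_swap.comp h2
  let g : (Fin k → Vec d × ℝ) × (Vec d × ℝ) → ℝ≥0∞ :=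
    fun z => ENNReal.ofReal ((f (z.1, z.2.1) - z.2.2) ^ 2)
  have hg : Measurable g := by
    have : Measurable fun z : (Fin k → Vec d × ℝ) × (Vec d × ℝ) => f (z.1, z.2.1) :=
      hf.comp (by fun_prop)
    fun_prop
  have h4 := h3.lintegral_comp hg
  have h5 : ∀ S : Fin K → Vec d × ℝ,
      ENNReal.ofReal ((f (fun i => S (Fin.castLE k.isLt.le i), (S k).1) - (S k).2) ^ 2)
      = g ((Prod.swap ∘ (MeasurableEquiv.piFinSuccAbove (fun _ => Vec d × ℝ) (Fin.last k)) ∘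
        fun (S : Fin K → Vec d × ℝ) i => S (Fin.castLE (Nat.succ_le_of_lt k.isLt) i)) S) := by
    intro S
    simp [g, MeasurableEquiv.piFinSuccAbove, Fin.insertNthEquiv]
    rfl
  simp_rw [h5]
  rw [h4, lintegral_prod _ hg.aemeasurable]
  have h6 : ∀ S : Fin k → Vec d × ℝ, ∫⁻ z, g (S, z) ∂(P.sampleLaw t)
      = (∫⁻ x, ENNReal.ofReal ((f (S, x) - inner ℝ t.2 x) ^ 2) ∂(isoGaussian t.1 P.sigmaX))
        + ENNReal.ofReal (P.sigmaY ^ 2) := by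
    intro S
    rw [P.lintegral_sampleLaw t (g := fun z => g (S, z)) (by fun_prop)]
    have h7 : ∀ x, ∫⁻ e, g (S, (x, inner ℝ t.2 x + e)) ∂(gaussianReal 0 (sqNNReal P.sigmaY))
        = ENNReal.ofReal ((f (S, x) - inner ℝ t.2 x) ^ 2) + ENNReal.ofReal (P.sigmaY ^ 2) := by
      intro x
      simp only [g, ← sub_sub]
      exact lintegral_sub_sq_gaussianReal _ _
    simp_rw [h7]
    rw [lintegral_add_right _ measurable_const]
    simp
  simp_rw [h6]
  rw [lintegral_add_right _ measurable_const, promptLaw, lintegral_prod]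
  · simp
  · fun_prop

end PretrainModel

/-! ### Integrability under the prior and continuity of the Bayes predictor -/

instance sigmaFinite_volume_sample (d : ℕ) : SigmaFinite (volume : Measure (Vec d × ℝ)) :=
  Measure.prod.instSigmaFinite

instance sigmaFinite_volume_prompt (d k : ℕ) : SigmaFinite (volume : Measure (Prompt d k)) :=
  Measure.prod.instSigmaFinite

instance isOpenPosMeasure_volume_sample (d : ℕ) :
    (volume : Measure (Vec d × ℝ)).IsOpenPosMeasure :=
  Measure.prod.instIsOpenPosMeasure

instance isOpenPosMeasure_volume_prompt (d k : ℕ) :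
    (volume : Measure (Prompt d k)).IsOpenPosMeasure :=
  Measure.prod.instIsOpenPosMeasure

namespace PretrainModel

variable {d M : ℕ} (P : PretrainModel d M)

theorem continuous_likelihood_task {k : ℕ} (q : Prompt d k) :
    Continuous fun t : Vec d × Vec d => P.likelihood q t := by
  unfold likelihood isoGaussianDensity gaussianPDFReal
  fun_prop

theorem continuous_likelihood_prompt (k : ℕ) (t : Vec d × Vec d) :
    Continuous fun q : Prompt d k => P.likelihood q t := by
  unfold likelihood isoGaussianDensity gaussianPDFReal
  fun_prop

theorem continuous_likelihood (k : ℕ) :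
    Continuous fun z : (Vec d × Vec d) × Prompt d k => P.likelihood z.2 z.1 := by
  unfold likelihood isoGaussianDensity gaussianPDFReal
  fun_prop

theorem prior_univ : P.prior Set.univ = 1 := by
  simp only [prior, Measure.coe_finsetSum, Finset.sum_apply, Measure.smul_apply, measure_univ,
    smul_eq_mul, mul_one]
  rw [← ENNReal.ofReal_sum_of_nonneg fun m _ => (P.weight_pos m).le, P.weight_sum,
    ENNReal.ofReal_one]

instance isProbabilityMeasure_prior : IsProbabilityMeasure P.prior := ⟨P.prior_univ⟩

theorem integrable_prior_iff {E : Type*} [NormedAddCommGroup E] {g : Vec d × Vec d → E} :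
    Integrable g P.prior ↔ ∀ m, Integrable g
      ((isoGaussian (P.muCenter m) P.sigmaMu).prod (isoGaussian (P.wCenter m) P.sigmaW)) := by
  simp only [prior, integrable_finsetSum_measure, Finset.mem_univ, true_implies]
  refine forall_congr' fun m => ?_
  rw [integrable_smul_measure (by simpa using P.weight_pos m) ENNReal.ofReal_ne_top]

theorem integral_prior {g : Vec d × Vec d → ℝ} (hg : Integrable g P.prior) :
    ∫ t, g t ∂P.prior = ∑ m, P.weight m * ∫ t, g t
      ∂((isoGaussian (P.muCenter m) P.sigmaMu).prod (isoGaussian (P.wCenter m) P.sigmaW)) := by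
  have hg' := P.integrable_prior_iff.1 hg
  rw [prior, integral_finsetSum_measure fun m _ =>
    (hg' m).smul_measure ENNReal.ofReal_ne_top]
  refine Finset.sum_congr rfl fun m _ => ?_
  rw [integral_smul_measure, ENNReal.toReal_ofReal (P.weight_pos m).le, smul_eq_mul]

theorem integrable_norm_sq_prior : Integrable (fun t : Vec d × Vec d => ‖t.2‖ ^ 2) P.prior :=
  P.integrable_prior_iff.2 fun m => Integrable.comp_snd
    (f := fun w : Vec d => ‖w‖ ^ 2)
    ((IsGaussian.memLp_two_id (μ := isoGaussian (P.wCenter m) P.sigmaW)).integrable_norm_pow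
      (by norm_num)) _

theorem integrable_snd_prior : Integrable (fun t : Vec d × Vec d => t.2) P.prior :=
  P.integrable_prior_iff.2 fun m => Integrable.comp_snd
    (f := fun w : Vec d => w)
    (IsGaussian.integrable_id (μ := isoGaussian (P.wCenter m) P.sigmaW)) _

theorem integrable_likelihood_smul {E : Type*} [NormedAddCommGroup E] [NormedSpace ℝ E]
    {k : ℕ} (q : Prompt d k)
    {g : Vec d × Vec d → E} (hg : Integrable g P.prior) :
    Integrable (fun t => P.likelihood q t • g t) P.prior := by
  obtain ⟨c, hc⟩ := P.likelihood_le k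
  refine hg.bdd_smul c ?_ ?_
  · exact (P.continuous_likelihood_task q).aestronglyMeasurable
  · refine .of_forall fun t => ?_
    rw [Real.norm_of_nonneg (P.likelihood_pos q t).le]
    exact hc q t

theorem integrable_likelihood {k : ℕ} (q : Prompt d k) :
    Integrable (P.likelihood q) P.prior := by
  simpa using P.integrable_likelihood_smul q (integrable_const (1 : ℝ))

theorem integrable_likelihood_mul_inner {k : ℕ} (q : Prompt d k) (x : Vec d) :
    Integrable (fun t => P.likelihood q t * inner ℝ t.2 x) P.prior :=
  P.integrable_likelihood_smul q (P.integrable_snd_prior.inner_const x)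

theorem integrable_inner_sq_prior (x : Vec d) :
    Integrable (fun t : Vec d × Vec d => (inner ℝ t.2 x : ℝ) ^ 2) P.prior := by
  refine (P.integrable_norm_sq_prior.mul_const (‖x‖ ^ 2)).mono'
    (by fun_prop) (.of_forall fun t => ?_)
  rw [Real.norm_of_nonneg (sq_nonneg _), ← mul_pow, ← sq_abs]
  exact pow_le_pow_left₀ (abs_nonneg _) (abs_real_inner_le_norm _ _) 2

theorem integrable_likelihood_mul_inner_sq {k : ℕ} (q : Prompt d k) (x : Vec d) :
    Integrable (fun t => P.likelihood q t * (inner ℝ t.2 x : ℝ) ^ 2) P.prior :=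
  P.integrable_likelihood_smul q (P.integrable_inner_sq_prior x)

theorem integral_likelihood_pos {k : ℕ} (q : Prompt d k) :
    0 < ∫ t, P.likelihood q t ∂P.prior := by
  rw [integral_pos_iff_support_of_nonneg (fun t => (P.likelihood_pos q t).le)
    (P.integrable_likelihood q)]
  rw [show Function.support (P.likelihood q) = Set.univ from
    Set.eq_univ_of_forall fun t => (P.likelihood_pos q t).ne']
  simp

theorem continuous_integral_likelihood (k : ℕ) :
    Continuous fun q : Prompt d k => ∫ t, P.likelihood q t ∂P.prior := by
  obtain ⟨c, hc⟩ := P.likelihood_le k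
  refine continuous_of_dominated (bound := fun _ => c) (fun q => ?_) (fun q => ?_)
    (integrable_const _) (.of_forall fun t => ?_)
  · exact (P.integrable_likelihood q).aestronglyMeasurable
  · refine .of_forall fun t => ?_
    rw [Real.norm_of_nonneg (P.likelihood_pos q t).le]
    exact hc q t
  · exact P.continuous_likelihood_prompt k t

theorem continuous_bayesPredictor (k : ℕ) : Continuous (P.bayesPredictor k) := by
  obtain ⟨c, hc⟩ := P.likelihood_le k
  -- Taking x_{k+1} out of the integral leaves a vector integral dominated by c‖w‖, independently of
  -- the prompt.
  have hvec : Continuous fun q : Prompt d k => ∫ t, P.likelihood q t • t.2 ∂P.prior := by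
    refine continuous_of_dominated (bound := fun t => c * ‖t.2‖) (fun q => ?_) (fun q => ?_)
      (P.integrable_snd_prior.norm.const_mul c) (.of_forall fun t => ?_)
    · exact (P.integrable_likelihood_smul q P.integrable_snd_prior).aestronglyMeasurable
    · refine .of_forall fun t => ?_
      rw [norm_smul, Real.norm_of_nonneg (P.likelihood_pos q t).le]
      exact mul_le_mul_of_nonneg_right (hc q t) (norm_nonneg _)
    · exact (P.continuous_likelihood_prompt k t).smul continuous_const
  have hnum : ∀ q : Prompt d k, ∫ t, P.likelihood q t * inner ℝ t.2 q.2 ∂P.prior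
      = inner ℝ q.2 (∫ t, P.likelihood q t • t.2 ∂P.prior) := by
    intro q
    rw [← integral_inner (P.integrable_likelihood_smul q P.integrable_snd_prior)]
    simp_rw [inner_smul_right, real_inner_comm]
  unfold bayesPredictor
  simp_rw [hnum]
  exact (continuous_snd.inner hvec).div (P.continuous_integral_likelihood k)
    fun q => (P.integral_likelihood_pos q).ne'

/-! ### Optimality and uniqueness of the Bayes predictor -/

/-- The mean squared error of `f` as an estimate of `⟨w, x_{k+1}⟩`. -/
def estimationRisk (k : ℕ) (f : Prompt d k → ℝ) : ℝ≥0∞ :=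
  ∫⁻ t, ∫⁻ q, ENNReal.ofReal ((f q - inner ℝ t.2 q.2) ^ 2) ∂(P.promptLaw k t) ∂P.prior

/-- Tonelli puts the prompt outside, and `integral_mul_sub_sq` applies to the posterior weights at
each prompt. The identity is additive in `ℝ≥0∞`, so it also covers predictors of infinite risk. -/
theorem estimationRisk_eq (k : ℕ) {f : Prompt d k → ℝ} (hf : Measurable f) :
    P.estimationRisk k f = P.estimationRisk k (P.bayesPredictor k)
      + ∫⁻ q, ENNReal.ofReal ((∫ t, P.likelihood q t ∂P.prior)
        * (f q - P.bayesPredictor k q) ^ 2) := by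
  have hswap : ∀ f : Prompt d k → ℝ, Measurable f → P.estimationRisk k f
      = ∫⁻ q, ENNReal.ofReal (∫ t, P.likelihood q t * (f q - inner ℝ t.2 q.2) ^ 2 ∂P.prior) := by
    intro f hf
    have hjoint : Measurable fun z : (Vec d × Vec d) × Prompt d k =>
        ENNReal.ofReal (P.likelihood z.2 z.1 * (f z.2 - inner ℝ z.1.2 z.2.2) ^ 2) := by
      have h1 : Measurable fun z : (Vec d × Vec d) × Prompt d k => P.likelihood z.2 z.1 :=
        (P.continuous_likelihood k).measurable
      have h2 : Measurable fun z : (Vec d × Vec d) × Prompt d k =>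
          (inner ℝ z.1.2 z.2.2 : ℝ) := by fun_prop
      fun_prop
    have hin : ∀ t, ∫⁻ q, ENNReal.ofReal ((f q - inner ℝ t.2 q.2) ^ 2) ∂(P.promptLaw k t)
        = ∫⁻ q, ENNReal.ofReal (P.likelihood q t * (f q - inner ℝ t.2 q.2) ^ 2) := by
      intro t
      have h1 : Measurable fun q : Prompt d k => ENNReal.ofReal (P.likelihood q t) :=
        (P.continuous_likelihood_prompt k t).measurable.ennreal_ofReal
      rw [promptLaw_eq_withDensity, lintegral_withDensity_eq_lintegral_mul _ h1 (by fun_prop)]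
      refine lintegral_congr fun q => ?_
      rw [Pi.mul_apply, ENNReal.ofReal_mul (P.likelihood_pos q t).le]
    rw [estimationRisk]
    simp_rw [hin]
    rw [lintegral_lintegral_swap hjoint.aemeasurable]
    refine lintegral_congr fun q => ?_
    rw [ofReal_integral_eq_lintegral_ofReal]
    · have := ((P.integrable_likelihood q).const_mul (f q ^ 2)).sub
        ((P.integrable_likelihood_mul_inner q q.2).const_mul (2 * f q))
      refine (this.add (P.integrable_likelihood_mul_inner_sq q q.2)).congr (.of_forall fun t => ?_)
      simp only [Pi.add_apply, Pi.sub_apply]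
      ring
    · exact .of_forall fun t => mul_nonneg (P.likelihood_pos q t).le (sq_nonneg _)
  have hB := (P.continuous_bayesPredictor k).measurable
  rw [hswap f hf, hswap _ hB, ← lintegral_add_right]
  · refine lintegral_congr fun q => ?_
    rw [integral_mul_sub_sq (P.integrable_likelihood q) (P.integrable_likelihood_mul_inner q q.2)
      (P.integrable_likelihood_mul_inner_sq q q.2) (P.integral_likelihood_pos q).ne' (f q),
      add_comm, ENNReal.ofReal_add]
    · rfl
    · exact integral_nonneg fun t => mul_nonneg (P.likelihood_pos q t).le (sq_nonneg _)
    · exact mul_nonneg (P.integral_likelihood_pos q).le (sq_nonneg _)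
  · have := (P.continuous_integral_likelihood k).measurable
    fun_prop

theorem pretrainRisk_eq {K : ℕ} {F : Predictor d K} (hF : ∀ k, Measurable (F k)) :
    P.pretrainRisk K F = ENNReal.ofReal (1 / (K : ℝ)) *
      ∑ k : Fin K, (P.estimationRisk k (F k) + ENNReal.ofReal (P.sigmaY ^ 2)) := by
  have hin : ∀ t, ∫⁻ S : Fin K → Vec d × ℝ, ENNReal.ofReal ((1 / (K : ℝ)) *
      ∑ k : Fin K, (F k (fun i => S (Fin.castLE k.isLt.le i), (S k).1) - (S k).2) ^ 2)
      ∂(Measure.pi fun _ => P.sampleLaw t)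
      = ENNReal.ofReal (1 / (K : ℝ)) * ∑ k : Fin K,
        ((∫⁻ q, ENNReal.ofReal ((F k q - inner ℝ t.2 q.2) ^ 2) ∂(P.promptLaw k t))
        + ENNReal.ofReal (P.sigmaY ^ 2)) := by
    intro t
    have hm : ∀ k : Fin K, Measurable fun S : Fin K → Vec d × ℝ =>
        ENNReal.ofReal ((F k (fun i => S (Fin.castLE k.isLt.le i), (S k).1) - (S k).2) ^ 2) := by
      intro k
      have : Measurable fun S : Fin K → Vec d × ℝ =>
          F k (fun i => S (Fin.castLE k.isLt.le i), (S k).1) := (hF k).comp (by fun_prop)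
      fun_prop
    simp_rw [ENNReal.ofReal_mul (show 0 ≤ 1 / (K : ℝ) by positivity),
      ENNReal.ofReal_sum_of_nonneg fun (k : Fin K) (_ : k ∈ Finset.univ) => sq_nonneg _]
    rw [lintegral_const_mul _ (Finset.measurable_fun_sum _ fun k _ => hm k),
      lintegral_finsetSum _ fun k _ => hm k]
    simp_rw [P.lintegral_sq_loss _ (hF _)]
  have hmeas : ∀ k : Fin K, Measurable fun t =>
      (∫⁻ q, ENNReal.ofReal ((F k q - inner ℝ t.2 q.2) ^ 2) ∂(P.promptLaw k t)) := by
    intro k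
    have h1 : Measurable fun z : (Vec d × Vec d) × Prompt d k => P.likelihood z.2 z.1 :=
      (P.continuous_likelihood k).measurable
    have h2 : Measurable fun z : (Vec d × Vec d) × Prompt d k =>
        F k z.2 := (hF k).comp measurable_snd
    have h3 : ∀ t, ∫⁻ q, ENNReal.ofReal ((F k q - inner ℝ t.2 q.2) ^ 2) ∂(P.promptLaw k t)
        = ∫⁻ q, ENNReal.ofReal (P.likelihood q t)
          * ENNReal.ofReal ((F k q - inner ℝ t.2 q.2) ^ 2) := by
      intro t
      have h1 : Measurable fun q : Prompt d k => ENNReal.ofReal (P.likelihood q t) :=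
        (P.continuous_likelihood_prompt k t).measurable.ennreal_ofReal
      have := hF k
      rw [promptLaw_eq_withDensity, lintegral_withDensity_eq_lintegral_mul _ h1 (by fun_prop)]
      rfl
    simp_rw [h3]
    refine Measurable.lintegral_prod_right' (f := fun z : (Vec d × Vec d) × Prompt d k =>
      ENNReal.ofReal (P.likelihood z.2 z.1) *
        ENNReal.ofReal ((F k z.2 - inner ℝ z.1.2 z.2.2) ^ 2)) ?_
    fun_prop
  rw [pretrainRisk]
  simp_rw [hin]
  rw [lintegral_const_mul, lintegral_finsetSum]
  · refine congrArg _ (Finset.sum_congr rfl fun k _ => ?_)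
    rw [lintegral_add_right _ measurable_const, estimationRisk]
    simp
  · exact fun k _ => (hmeas k).add_const _
  · exact Finset.measurable_fun_sum _ fun k _ => (hmeas k).add_const _

theorem isOptimal_bayesPredictor (K : ℕ) : P.IsOptimal K (fun k => P.bayesPredictor k) := by
  have hB : ∀ k : Fin K, Measurable (P.bayesPredictor k) :=
    fun k => (P.continuous_bayesPredictor k).measurable
  refine ⟨hB, fun G hG => ?_⟩
  rw [P.pretrainRisk_eq hB, P.pretrainRisk_eq hG]
  gcongr with k
  rw [P.estimationRisk_eq k (hG k)]
  exact le_self_add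

/-- Comparison with the zero predictor makes the Bayes risk finite, so that it can be cancelled in
the uniqueness argument. -/
theorem estimationRisk_zero_lt_top (k : ℕ) : P.estimationRisk k (fun _ => 0) < ∞ := by
  have hin : ∀ t : Vec d × Vec d,
      ∫⁻ q, ENNReal.ofReal ((0 - inner ℝ t.2 q.2) ^ 2) ∂(P.promptLaw k t)
      ≤ ENNReal.ofReal (‖t.2‖ ^ 2 * (‖t.1‖ ^ 2 + d * P.sigmaX ^ 2)) := by
    intro t
    rw [ENNReal.ofReal_mul (by positivity), ← lintegral_norm_sq_isoGaussian,
      ← lintegral_const_mul _ (by fun_prop)]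
    have hsnd : MeasurePreserving Prod.snd (P.promptLaw k t) (isoGaussian t.1 P.sigmaX) := by
      unfold promptLaw; exact measurePreserving_snd
    rw [← hsnd.lintegral_comp (by fun_prop)]
    refine lintegral_mono fun q => ?_
    rw [← ENNReal.ofReal_mul (by positivity), ← mul_pow, zero_sub, neg_sq, ← sq_abs]
    exact ENNReal.ofReal_le_ofReal
      (pow_le_pow_left₀ (abs_nonneg _) (abs_real_inner_le_norm _ _) 2)
  refine (lintegral_mono hin).trans_lt (Integrable.lintegral_lt_top ?_)
  refine P.integrable_prior_iff.2 fun m => ?_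
  have h1 : ∀ (c : Vec d) (s : ℝ), Integrable (fun x : Vec d => ‖x‖ ^ 2) (isoGaussian c s) :=
    fun c s => (IsGaussian.memLp_two_id (μ := isoGaussian c s)).integrable_norm_pow (by norm_num)
  have := Integrable.mul_prod
    ((h1 (P.muCenter m) P.sigmaMu).add (integrable_const ((d : ℝ) * P.sigmaX ^ 2)))
    (h1 (P.wCenter m) P.sigmaW)
  refine this.congr (.of_forall fun t => ?_)
  simp [mul_comm]

/-- A continuous predictor attaining the optimal pretraining risk is the Bayes predictor. -/
theorem eq_bayesPredictor_of_isOptimal {K : ℕ} {F : Predictor d K} (hc : ∀ j, Continuous (F j))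
    (hF : P.IsOptimal K F) (k : Fin K) : F k = P.bayesPredictor k := by
  classical
  have hB : ∀ k : Fin K, Measurable (P.bayesPredictor k) :=
    fun k => (P.continuous_bayesPredictor k).measurable
  have hKpos : 0 < K := k.pos
  have hfin : ∀ j : ℕ, P.estimationRisk j (P.bayesPredictor j) < ∞ := fun j =>
    (le_self_add.trans (P.estimationRisk_eq j measurable_const).ge).trans_lt
      (P.estimationRisk_zero_lt_top j)
  have hle := hF.2 _ hB
  rw [P.pretrainRisk_eq hB, P.pretrainRisk_eq hF.1] at hle
  rw [ENNReal.mul_le_mul_iff_right (by simpa using hKpos.ne') ENNReal.ofReal_ne_top] at hle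
  simp_rw [fun k : Fin K => P.estimationRisk_eq k (hF.1 k)] at hle
  have hsum : ∑ j : Fin K, (P.estimationRisk j (P.bayesPredictor j) +
      ENNReal.ofReal (P.sigmaY ^ 2)) ≠ ∞ := by
    refine ENNReal.sum_ne_top.2 fun j _ => ?_
    exact ENNReal.add_ne_top.2 ⟨(hfin j).ne, ENNReal.ofReal_ne_top⟩
  simp_rw [add_right_comm _ _ (ENNReal.ofReal (P.sigmaY ^ 2)), Finset.sum_add_distrib (f := fun
    j : Fin K => P.estimationRisk j (P.bayesPredictor j) + ENNReal.ofReal (P.sigmaY ^ 2))] at hle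
  have hzero := le_antisymm ((ENNReal.add_le_add_iff_left hsum).1 (hle.trans_eq (add_zero _).symm))
    zero_le
  have hk := (Finset.sum_eq_zero_iff.1 hzero) k (Finset.mem_univ k)
  rw [lintegral_eq_zero_iff] at hk
  · refine Measure.eq_of_ae_eq (μ := volume) ?_ (hc k) (P.continuous_bayesPredictor k)
    filter_upwards [hk] with q hq
    have hq' : (∫ t, P.likelihood q t ∂P.prior) * (F k q - P.bayesPredictor k q) ^ 2 ≤ 0 :=
      ENNReal.ofReal_eq_zero.1 hq
    have h2 : (F k q - P.bayesPredictor k q) ^ 2 ≤ 0 :=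
      nonpos_of_mul_nonpos_right hq' (P.integral_likelihood_pos q)
    exact sub_eq_zero.1 (pow_eq_zero_iff two_ne_zero |>.1 (le_antisymm h2 (sq_nonneg _)))
  · have h1 := (P.continuous_integral_likelihood k).measurable
    have h2 := hF.1 k
    have h3 := hB k
    fun_prop

end PretrainModel

/-! ### The posterior mean on noiseless labels -/

/-- The ridge equation `(I + δ ∑ᵢ xᵢ xᵢᵀ) v = b` is solvable. -/
theorem exists_ridge_solution {d k : ℕ} (X : Fin k → Vec d) {δ : ℝ} (hδ : 0 ≤ δ) (b : Vec d) :
    ∃ v : Vec d, v + δ • ∑ i, (inner ℝ (X i) v : ℝ) • X i = b := by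
  let T : Vec d →ₗ[ℝ] Vec d := LinearMap.id + δ • ∑ i, ((innerₛₗ ℝ (X i)).smulRight (X i))
  have hT : ∀ v, T v = v + δ • ∑ i, (inner ℝ (X i) v : ℝ) • X i := by
    intro v
    simp [T]
  have hinj : Function.Injective T := by
    refine (injective_iff_map_eq_zero T).2 fun v hv => ?_
    have h : (inner ℝ v (T v) : ℝ) = ‖v‖ ^ 2 + δ * ∑ i, (inner ℝ (X i) v : ℝ) ^ 2 := by
      rw [hT, inner_add_right, inner_smul_right, inner_sum, real_inner_self_eq_norm_sq]
      simp_rw [inner_smul_right, real_inner_comm, pow_two]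
    rw [hv, inner_zero_right] at h
    have h2 : 0 ≤ δ * ∑ i, (inner ℝ (X i) v : ℝ) ^ 2 := by positivity
    exact norm_eq_zero.1 (pow_eq_zero_iff two_ne_zero |>.1 (by linarith [sq_nonneg ‖v‖]))
  obtain ⟨v, hv⟩ := LinearMap.injective_iff_surjective.1 hinj b
  exact ⟨v, (hT v).symm.trans hv⟩

/-- Pairing the equation with v gives (1 + δl)‖v‖² ≤ ⟨v, b⟩ ≤ ‖v‖‖b‖. -/
theorem norm_ridge_solution_le {d k : ℕ} {X : Fin k → Vec d} {δ l : ℝ} (hδ : 0 ≤ δ) (hl : 0 ≤ l)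
    (hX : ∀ v, l * ‖v‖ ^ 2 ≤ ∑ i, (inner ℝ (X i) v : ℝ) ^ 2) {v b : Vec d}
    (hv : v + δ • ∑ i, (inner ℝ (X i) v : ℝ) • X i = b) :
    ‖v‖ ≤ ‖b‖ / (1 + δ * l) := by
  have h : (inner ℝ v b : ℝ) = ‖v‖ ^ 2 + δ * ∑ i, (inner ℝ (X i) v : ℝ) ^ 2 := by
    rw [← hv, inner_add_right, inner_smul_right, inner_sum, real_inner_self_eq_norm_sq]
    simp_rw [inner_smul_right, real_inner_comm, pow_two]
  have h1 := real_inner_le_norm v b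
  have h2 := mul_le_mul_of_nonneg_left (hX v) hδ
  rw [le_div_iff₀ (by positivity)]
  rcases (norm_nonneg v).eq_or_lt with h0 | h0
  · rw [← h0, zero_mul]; exact norm_nonneg _
  · refine le_of_mul_le_mul_left ?_ h0
    nlinarith

/-- The integral of a function that is odd about a point vanishes. -/
theorem integral_eq_zero_of_odd_about {d : ℕ} {h : Vec d → ℝ} (c : Vec d)
    (hh : ∀ w, h (c - w) = - h w) : ∫ w, h w = 0 := by
  -- The change of variables needs no integrability, since both integrals default to 0 together.
  have h1 := integral_sub_left_eq_self h volume c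
  simp_rw [hh, integral_neg] at h1
  linarith

/-- The negative log-posterior is quadratic in w, and the ridge equation says that w* + v is its
critical point; hence it is symmetric about that point. -/
theorem ridge_exponent_reflect {d k : ℕ} {X : Fin k → Vec d} {a b : ℝ} (ha : 0 < a) (hb : 0 < b)
    {wStar wm v : Vec d}
    (hv : v + (a ^ 2 / b ^ 2) • ∑ i, (inner ℝ (X i) v : ℝ) • X i = wm - wStar) (w : Vec d) :
    ‖(2 : ℝ) • (wStar + v) - w - wm‖ ^ 2 / (2 * a ^ 2)
        + ∑ i, (inner ℝ (X i) wStar - inner ℝ ((2 : ℝ) • (wStar + v) - w) (X i)) ^ 2 / (2 * b ^ 2)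
      = ‖w - wm‖ ^ 2 / (2 * a ^ 2)
        + ∑ i, (inner ℝ (X i) wStar - inner ℝ w (X i)) ^ 2 / (2 * b ^ 2) := by
  obtain ⟨u, rfl⟩ : ∃ u, w = wStar + v + u := ⟨w - (wStar + v), by abel⟩
  obtain rfl : wm = wStar + v + (a ^ 2 / b ^ 2) • ∑ i, (inner ℝ (X i) v : ℝ) • X i := by
    rw [add_assoc, hv]; abel
  set s := ∑ i, (inner ℝ (X i) v : ℝ) • X i with hs
  have e1 : (2 : ℝ) • (wStar + v) - (wStar + v + u) = wStar + v - u := by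
    rw [two_smul]; abel
  have hsu : (inner ℝ u s : ℝ) = ∑ i, (inner ℝ (X i) v : ℝ) * inner ℝ u (X i) := by
    rw [hs, inner_sum]
    simp_rw [inner_smul_right]
  have e2 : wStar + v - u - (wStar + v + (a ^ 2 / b ^ 2) • s) = -(u + (a ^ 2 / b ^ 2) • s) := by
    abel
  have e3 : wStar + v + u - (wStar + v + (a ^ 2 / b ^ 2) • s) = u - (a ^ 2 / b ^ 2) • s := by
    abel
  rw [e1, e2, e3, norm_neg, norm_add_sq_real, norm_sub_sq_real, inner_smul_right, hsu]
  have e4 : ∀ i, (inner ℝ (X i) wStar - inner ℝ (wStar + v - u) (X i)) ^ 2 / (2 * b ^ 2)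
      = (inner ℝ (X i) wStar - inner ℝ (wStar + v + u) (X i)) ^ 2 / (2 * b ^ 2)
        - 2 / b ^ 2 * ((inner ℝ (X i) v : ℝ) * inner ℝ u (X i)) := by
    intro i
    rw [inner_sub_left, inner_add_left, inner_add_left, inner_add_left,
      real_inner_comm (X i) wStar, real_inner_comm (X i) v]
    field_simp
    ring
  simp_rw [e4]
  rw [Finset.sum_sub_distrib, ← Finset.mul_sum]
  field_simp
  ring

namespace PretrainModel

variable {d M : ℕ} (P : PretrainModel d M)

/-- The posterior mean of `w` in the mixture component centered at `wm` is `w* + v`. -/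
theorem integral_label_likelihood_mul_inner {k : ℕ} (X : Fin k → Vec d) {wStar wm v : Vec d}
    (hv : v + P.deltaW • ∑ i, (inner ℝ (X i) v : ℝ) • X i = wm - wStar) (x : Vec d) :
    ∫ w, (∏ i, gaussianPDFReal (inner ℝ w (X i)) (sqNNReal P.sigmaY) (inner ℝ (X i) wStar))
      * inner ℝ (w - wStar - v) x ∂(isoGaussian wm P.sigmaW) = 0 := by
  have hx : Measurable fun w => ENNReal.ofReal (isoGaussianDensity wm P.sigmaW w) :=
    ((continuous_isoGaussianDensity P.sigmaW).comp
      (continuous_const.prodMk continuous_id)).measurable.ennreal_ofReal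
  rw [isoGaussian_eq_withDensity _ P.sigmaW_pos, integral_withDensity_eq_integral_toReal_smul hx
    (.of_forall fun _ => ENNReal.ofReal_lt_top)]
  refine integral_eq_zero_of_odd_about ((2 : ℝ) • (wStar + v)) fun w => ?_
  have hpos := fun w => (isoGaussianDensity_pos wm P.sigmaW_pos w).le
  simp only [ENNReal.toReal_ofReal (hpos _), smul_eq_mul, ← mul_assoc]
  have hval : ∀ w, isoGaussianDensity wm P.sigmaW w *
      ∏ i, gaussianPDFReal (inner ℝ w (X i)) (sqNNReal P.sigmaY) (inner ℝ (X i) wStar)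
      = (Real.sqrt (2 * Real.pi * P.sigmaW ^ 2))⁻¹ ^ d
        * (∏ _i : Fin k, (Real.sqrt (2 * Real.pi * P.sigmaY ^ 2))⁻¹) *
        Real.exp (-(‖w - wm‖ ^ 2 / (2 * P.sigmaW ^ 2)
        + ∑ i, (inner ℝ (X i) wStar - inner ℝ w (X i)) ^ 2 / (2 * P.sigmaY ^ 2))) := by
    intro w
    simp only [isoGaussianDensity, gaussianPDFReal, Finset.prod_mul_distrib, ← Real.exp_sum,
      coe_sqNNReal, neg_add, Real.exp_add, neg_div, Finset.sum_neg_distrib]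
    ring
  rw [hval, hval, ridge_exponent_reflect P.sigmaW_pos P.sigmaY_pos hv]
  have e : (2 : ℝ) • (wStar + v) - w - wStar - v = -(w - wStar - v) := by
    rw [two_smul]; abel
  rw [e, inner_neg_left, mul_neg]

/-- The error is the average of ⟨v_m, x⟩ with the posterior probabilities of the components as
weights, so a bound common to all m passes to it. The inputs' evidence about μ only affects these
weights. -/
theorem sq_bayesPredictor_sub_le {k : ℕ} (X : Fin k → Vec d) (x : Vec d) {wStar : Vec d}
    (hw : ‖wStar‖ = 1) {l : ℝ} (hl : 0 ≤ l)
    (hX : ∀ v, l * ‖v‖ ^ 2 ≤ ∑ i, (inner ℝ (X i) v : ℝ) ^ 2) :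
    (P.bayesPredictor k (fun i => (X i, inner ℝ (X i) wStar), x) - inner ℝ x wStar) ^ 2
      ≤ 4 / (1 + P.deltaW * l) ^ 2 * ‖x‖ ^ 2 := by
  have hδ : 0 ≤ P.deltaW := by unfold deltaW; positivity
  set q : Prompt d k := (fun i => (X i, inner ℝ (X i) wStar), x) with hq
  choose v hv using fun m => exists_ridge_solution X hδ (P.wCenter m - wStar)
  have hvn : ∀ m, ‖v m‖ ≤ 2 / (1 + P.deltaW * l) := fun m => by
    refine (norm_ridge_solution_le hδ hl hX (hv m)).trans ?_
    gcongr
    refine (norm_sub_le _ _).trans ?_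
    rw [P.norm_wCenter, hw]; norm_num
  set r := 2 / (1 + P.deltaW * l) * ‖x‖ with hr
  have hvx : ∀ m, |(inner ℝ (v m) x : ℝ)| ≤ r := fun m =>
    (abs_real_inner_le_norm _ _).trans (mul_le_mul_of_nonneg_right (hvn m) (norm_nonneg _))
  let ν : Fin M → Measure (Vec d × Vec d) := fun m =>
    (isoGaussian (P.muCenter m) P.sigmaMu).prod (isoGaussian (P.wCenter m) P.sigmaW)
  have hLi := P.integrable_likelihood q
  have hLν : ∀ m, Integrable (P.likelihood q) (ν m) := P.integrable_prior_iff.1 hLi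
  have hLx := P.integrable_likelihood_mul_inner q x
  have hD : Integrable (fun t => P.likelihood q t * inner ℝ t.2 x
      - P.likelihood q t * inner ℝ x wStar) P.prior := hLx.sub (hLi.mul_const _)
  have hcomp : ∀ m, ∫ t, (P.likelihood q t * inner ℝ t.2 x
      - P.likelihood q t * inner ℝ x wStar) ∂(ν m)
      = inner ℝ (v m) x * ∫ t, P.likelihood q t ∂(ν m) := by
    intro m
    -- Under a product component the integral factors, and its w-factor vanishes by symmetry.
    have h0 : ∫ t, P.likelihood q t * inner ℝ (t.2 - wStar - v m) x ∂(ν m) = 0 := by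
      have hfac : ∀ t : Vec d × Vec d, P.likelihood q t * inner ℝ (t.2 - wStar - v m) x
          = ((∏ i, isoGaussianDensity t.1 P.sigmaX (X i)) * isoGaussianDensity t.1 P.sigmaX x)
          * ((∏ i, gaussianPDFReal (inner ℝ t.2 (X i)) (sqNNReal P.sigmaY)
            (inner ℝ (X i) wStar)) * inner ℝ (t.2 - wStar - v m) x) := by
        intro t
        rw [likelihood_eq, hq, Finset.prod_mul_distrib]
        ring
      simp_rw [hfac]
      rw [integral_prod_mul (fun μ : Vec d => (∏ i, isoGaussianDensity μ P.sigmaX (X i))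
          * isoGaussianDensity μ P.sigmaX x)
        (fun w : Vec d => (∏ i, gaussianPDFReal (inner ℝ w (X i)) (sqNNReal P.sigmaY)
            (inner ℝ (X i) wStar)) * inner ℝ (w - wStar - v m) x),
        P.integral_label_likelihood_mul_inner X (hv m) x, mul_zero]
    rw [← integral_const_mul, ← sub_eq_zero, ← integral_sub
      (P.integrable_prior_iff.1 hD m) ((hLν m).const_mul _), ← h0]
    refine integral_congr_ae (.of_forall fun t => ?_)
    simp only [inner_sub_left, real_inner_comm x wStar]
    ring
  have hZ := P.integral_likelihood_pos q
  have habs : |∫ t, (P.likelihood q t * inner ℝ t.2 x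
      - P.likelihood q t * inner ℝ x wStar) ∂P.prior| ≤ r * ∫ t, P.likelihood q t ∂P.prior := by
    rw [P.integral_prior hD, P.integral_prior hLi, Finset.mul_sum]
    refine (Finset.abs_sum_le_sum_abs _ _).trans (Finset.sum_le_sum fun m _ => ?_)
    have := hcomp m
    simp only [ν] at this
    rw [this]
    have hn : 0 ≤ ∫ t, P.likelihood q t
        ∂((isoGaussian (P.muCenter m) P.sigmaMu).prod (isoGaussian (P.wCenter m) P.sigmaW)) :=
      integral_nonneg fun t => (P.likelihood_pos q t).le
    rw [abs_mul, abs_mul, abs_of_pos (P.weight_pos m), abs_of_nonneg hn]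
    have := mul_le_mul_of_nonneg_right (hvx m) (mul_nonneg (P.weight_pos m).le hn)
    linarith
  rw [integral_sub hLx (hLi.mul_const _), integral_mul_const] at habs
  have hB : P.bayesPredictor k q - inner ℝ x wStar
      = ((∫ t, P.likelihood q t * inner ℝ t.2 x ∂P.prior)
        - (∫ t, P.likelihood q t ∂P.prior) * inner ℝ x wStar) / ∫ t, P.likelihood q t ∂P.prior := by
    rw [sub_div, mul_div_cancel_left₀ _ hZ.ne']
    rfl
  have hBr : |P.bayesPredictor k q - inner ℝ x wStar| ≤ r := by
    rw [hB, abs_div, abs_of_pos hZ]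
    exact div_le_of_le_mul₀ hZ.le (by positivity) habs
  calc _ = |P.bayesPredictor k q - inner ℝ x wStar| ^ 2 := (sq_abs _).symm
    _ ≤ r ^ 2 := pow_le_pow_left₀ (abs_nonneg _) hBr 2
    _ = _ := by rw [hr, mul_pow, div_pow]; norm_num

end PretrainModel

/-! ### Exponential moments and concentration of the Gram matrix -/

theorem exp_le_one_add_add_sq_mul_exp_abs (z : ℝ) :
    Real.exp z ≤ 1 + z + z ^ 2 * Real.exp |z| := by
  have h := Complex.norm_exp_sub_sum_le_norm_mul_exp (z : ℂ) 2
  simp only [Finset.sum_range_succ, Finset.sum_range_zero, Nat.factorial, pow_zero, pow_one,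
    Nat.cast_one, div_one, zero_add, Complex.norm_real, Real.norm_eq_abs, sq_abs, mul_one] at h
  rw [← Complex.ofReal_exp, ← Complex.ofReal_one, ← Complex.ofReal_add, ← Complex.ofReal_sub,
    Complex.norm_real, Real.norm_eq_abs] at h
  linarith [le_abs_self (Real.exp z - (1 + z))]

/-- A sub-exponential random variable has a sub-Gaussian moment generating function near `0`. -/
theorem lintegral_exp_centered_le {E : Type*} [MeasurableSpace E] {ν : Measure E}
    [IsProbabilityMeasure ν] {Z : E → ℝ} (hZ : Measurable Z) {c : ℝ} (hc : 0 < c)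
    (hexp : Integrable (fun x => Real.exp (c * |Z x|)) ν) :
    ∃ A : ℝ, 0 ≤ A ∧ ∀ s : ℝ, |s| ≤ c / 2 →
      ∫⁻ x, ENNReal.ofReal (Real.exp (s * (Z x - ∫ y, Z y ∂ν))) ∂ν
        ≤ ENNReal.ofReal (Real.exp (A * s ^ 2)) := by
  set m := ∫ y, Z y ∂ν with hm
  have hZi : Integrable Z ν := by
    refine (hexp.const_mul (1 / c)).mono' hZ.aestronglyMeasurable (.of_forall fun x => ?_)
    rw [Real.norm_eq_abs, one_div, ← div_eq_inv_mul, le_div_iff₀ hc]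
    linarith [Real.add_one_le_exp (c * |Z x|)]
  have hW : Integrable (fun x => Real.exp (c * |Z x - m|)) ν := by
    refine (hexp.const_mul (Real.exp (c * |m|))).mono' (by fun_prop) (.of_forall fun x => ?_)
    rw [Real.norm_of_nonneg (Real.exp_pos _).le, ← Real.exp_add, Real.exp_le_exp, ← mul_add]
    exact mul_le_mul_of_nonneg_left ((abs_sub _ _).trans_eq (add_comm _ _)) hc.le
  have hWi : Integrable (fun x => Z x - m) ν := hZi.sub (integrable_const _)
  refine ⟨8 / c ^ 2 * ∫ x, Real.exp (c * |Z x - m|) ∂ν, by positivity, fun s hs => ?_⟩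
  have hpt : ∀ x, Real.exp (s * (Z x - m))
      ≤ 1 + s * (Z x - m) + s ^ 2 * (8 / c ^ 2 * Real.exp (c * |Z x - m|)) := by
    intro x
    refine (exp_le_one_add_add_sq_mul_exp_abs _).trans ?_
    rw [mul_pow, mul_assoc]
    set W := Z x - m
    -- The budget exp(c|W|) is split in halves: one dominates exp|sW|, hence |s| ≤ c/2; the other
    -- dominates W², and (c|W|/2)²/2 ≤ exp(c|W|/2) yields 8/c².
    have h1 : Real.exp |s * W| ≤ Real.exp (c / 2 * |W|) := by
      rw [Real.exp_le_exp, abs_mul]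
      exact mul_le_mul_of_nonneg_right hs (abs_nonneg _)
    have h2 : W ^ 2 ≤ 8 / c ^ 2 * Real.exp (c / 2 * |W|) := by
      have := Real.quadratic_le_exp_of_nonneg (show 0 ≤ c / 2 * |W| by positivity)
      have h3 : (c / 2 * |W|) ^ 2 / 2 ≤ Real.exp (c / 2 * |W|) := by
        have : 0 ≤ c / 2 * |W| := by positivity
        linarith
      rw [mul_pow, sq_abs] at h3
      rw [div_mul_eq_mul_div, le_div_iff₀ (by positivity)]
      linarith
    have h4 : Real.exp (c * |W|) = Real.exp (c / 2 * |W|) * Real.exp (c / 2 * |W|) := by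
      rw [← Real.exp_add]; congr 1; ring
    have h5 : W ^ 2 * Real.exp |s * W| ≤ 8 / c ^ 2 * Real.exp (c * |W|) := by
      rw [h4, ← mul_assoc]
      exact mul_le_mul h2 h1 (Real.exp_pos _).le (by positivity)
    have := mul_le_mul_of_nonneg_left h5 (sq_nonneg s)
    linarith
  have hi1 : Integrable (fun x => 1 + s * (Z x - m)) ν :=
    (integrable_const _).add (hWi.const_mul s)
  have hi2 : Integrable (fun x => s ^ 2 * (8 / c ^ 2 * Real.exp (c * |Z x - m|))) ν :=
    (hW.const_mul _).const_mul _
  refine (lintegral_mono fun x => ENNReal.ofReal_le_ofReal (hpt x)).trans ?_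
  have hi : Integrable (fun x => 1 + s * (Z x - m)
      + s ^ 2 * (8 / c ^ 2 * Real.exp (c * |Z x - m|))) ν := hi1.add hi2
  rw [← ofReal_integral_eq_lintegral_ofReal hi
    (.of_forall fun x => (Real.exp_pos _).le.trans (hpt x))]
  refine ENNReal.ofReal_le_ofReal ?_
  have hcent : ∫ x, (Z x - m) ∂ν = 0 := by
    rw [integral_sub hZi (integrable_const _)]; simp [hm]
  rw [integral_add hi1 hi2, integral_add (integrable_const _) (hWi.const_mul s),
    integral_const_mul, integral_const_mul, integral_const_mul, hcent]
  simp only [integral_const, probReal_univ, smul_eq_mul, mul_one, mul_zero, add_zero]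
  rw [mul_comm (s ^ 2), add_comm]
  exact Real.add_one_le_exp _

/-- If the empirical second moments are entrywise close to those of `N(c, τ² I)`, the smallest
eigenvalue of the Gram matrix is bounded below. -/
theorem sum_inner_sq_ge {d k : ℕ} (X : Fin k → Vec d) (c : Vec d) (tau t : ℝ)
    (h : ∀ a b, |∑ i, (X i a * X i b - (c a * c b + if a = b then tau ^ 2 else 0))| ≤ t)
    (v : Vec d) :
    (k * tau ^ 2 - d * t) * ‖v‖ ^ 2 ≤ ∑ i, (inner ℝ (X i) v : ℝ) ^ 2 := by
  set D : Fin d → Fin d → ℝ := fun a b =>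
    ∑ i, (X i a * X i b - (c a * c b + if a = b then tau ^ 2 else 0)) with hD
  have hin : ∀ x : Vec d, (inner ℝ x v : ℝ) ^ 2 = ∑ a, ∑ b, v a * v b * (x a * x b) := by
    intro x
    rw [pow_two, PiLp.inner_apply, Finset.sum_mul_sum]
    refine Finset.sum_congr rfl fun a _ => Finset.sum_congr rfl fun b _ => ?_
    simp; ring
  have hdiag : ∑ a, ∑ b, v a * v b * (if a = b then tau ^ 2 else 0) = tau ^ 2 * ‖v‖ ^ 2 := by
    rw [EuclideanSpace.real_norm_sq_eq, Finset.mul_sum]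
    refine Finset.sum_congr rfl fun a _ => ?_
    simp only [mul_ite, mul_zero, Finset.sum_ite_eq, Finset.mem_univ, if_true]
    ring
  have hsum : ∑ i, (inner ℝ (X i) v : ℝ) ^ 2
      = (∑ a, ∑ b, v a * v b * D a b) + k * ((inner ℝ c v : ℝ) ^ 2 + tau ^ 2 * ‖v‖ ^ 2) := by
    have hsplit : ∀ i, (inner ℝ (X i) v : ℝ) ^ 2
        = (∑ a, ∑ b, v a * v b *
          (X i a * X i b - (c a * c b + if a = b then tau ^ 2 else 0)))
          + ((inner ℝ c v : ℝ) ^ 2 + tau ^ 2 * ‖v‖ ^ 2) := by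
      intro i
      rw [hin, hin, ← hdiag]
      simp_rw [← Finset.sum_add_distrib]
      refine Finset.sum_congr rfl fun a _ => Finset.sum_congr rfl fun b _ => ?_
      ring
    simp_rw [hsplit]
    rw [Finset.sum_add_distrib]
    congr 1
    · rw [Finset.sum_comm]
      refine Finset.sum_congr rfl fun a _ => ?_
      rw [Finset.sum_comm]
      refine Finset.sum_congr rfl fun b _ => ?_
      rw [hD, Finset.mul_sum]
    · simp [mul_add]
  have hlow : -(t * (d * ‖v‖ ^ 2)) ≤ ∑ a, ∑ b, v a * v b * D a b := by
    have h1 : ∑ a, ∑ b, -(t * (|v a| * |v b|)) ≤ ∑ a, ∑ b, v a * v b * D a b := by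
      refine Finset.sum_le_sum fun a _ => Finset.sum_le_sum fun b _ => ?_
      have h2 : |v a * v b * D a b| ≤ |v a| * |v b| * t := by
        rw [abs_mul, abs_mul]
        exact mul_le_mul_of_nonneg_left (h a b) (by positivity)
      linarith [neg_abs_le (v a * v b * D a b)]
    have h3 : ∑ a, ∑ b, -(t * (|v a| * |v b|)) = -(t * (∑ a, |v a|) ^ 2) := by
      rw [pow_two, Finset.sum_mul_sum]
      simp_rw [Finset.sum_neg_distrib, Finset.mul_sum]
    have h4 : (∑ a, |v a|) ^ 2 ≤ d * ‖v‖ ^ 2 := by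
      have := sq_sum_le_card_mul_sum_sq (s := (Finset.univ : Finset (Fin d))) (f := fun a => |v a|)
      simpa [EuclideanSpace.real_norm_sq_eq] using this
    -- Only for d = 0 is the hypothesis vacuous, so that t could be negative.
    rcases isEmpty_or_nonempty (Fin d) with he | ⟨⟨a⟩⟩
    · have : d = 0 := by_contra fun h0 => he.false ⟨0, Nat.pos_of_ne_zero h0⟩
      subst this
      simp
    · have ht : 0 ≤ t := (abs_nonneg _).trans (h a a)
      have := mul_le_mul_of_nonneg_left h4 ht
      linarith
  rw [hsum]
  -- The contribution of the mean c is positive semidefinite and is dropped.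
  have : 0 ≤ (k : ℝ) * (inner ℝ c v : ℝ) ^ 2 := by positivity
  linarith

/-- By Fernique's theorem exp(C‖x‖²) is integrable, so each product of coordinates is
sub-exponential. Summing the finitely many constants makes `A` uniform in the entry. -/
theorem lintegral_exp_coord_mul_coord_le {d : ℕ} (c : Vec d) (tau : ℝ) :
    ∃ A s₀ : ℝ, 0 < s₀ ∧ ∀ (a b : Fin d) (s : ℝ), |s| ≤ s₀ →
      ∫⁻ x, ENNReal.ofReal (Real.exp (s *
        (x a * x b - (c a * c b + if a = b then tau ^ 2 else 0)))) ∂(isoGaussian c tau)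
        ≤ ENNReal.ofReal (Real.exp (A * s ^ 2)) := by
  obtain ⟨C, hC, hint⟩ := IsGaussian.exists_integrable_exp_sq (isoGaussian c tau)
  have hcoord : ∀ a b : Fin d,
      Integrable (fun x : Vec d => Real.exp (C * |x a * x b|)) (isoGaussian c tau) := by
    intro a b
    refine hint.mono' (by fun_prop) (.of_forall fun x => ?_)
    rw [Real.norm_of_nonneg (Real.exp_pos _).le, Real.exp_le_exp, abs_mul, pow_two]
    have h1 : ∀ a, |x a| ≤ ‖x‖ := fun a => PiLp.norm_apply_le x a
    gcongr
    · exact h1 a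
    · exact h1 b
  choose A hA0 hA using fun a b : Fin d =>
    lintegral_exp_centered_le (Z := fun x : Vec d => x a * x b) (by fun_prop) hC (hcoord a b)
  refine ⟨∑ a, ∑ b, A a b, C / 2, by positivity, fun a b s hs => ?_⟩
  have h := hA a b s hs
  simp only [integral_coord_mul_coord_isoGaussian] at h
  refine h.trans (ENNReal.ofReal_le_ofReal (Real.exp_le_exp.2 ?_))
  refine mul_le_mul_of_nonneg_right ?_ (sq_nonneg s)
  exact (Finset.single_le_sum (f := fun b => A a b) (fun b _ => hA0 a b) (Finset.mem_univ b)).trans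
    (Finset.single_le_sum (f := fun a => ∑ b, A a b)
      (fun a _ => Finset.sum_nonneg fun b _ => hA0 a b) (Finset.mem_univ a))

/-- The joint exponential moment of the `k` deviations, weighted by the norm of the last input. -/
theorem lintegral_exp_sum_mul_norm_sq_le {d : ℕ} {c : Vec d} {tau B : ℝ} {h : Vec d → ℝ}
    (hh : Measurable h) (hB : ∫⁻ x, ENNReal.ofReal (Real.exp (h x)) ∂(isoGaussian c tau)
      ≤ ENNReal.ofReal (Real.exp B)) (k : ℕ) :
    ∫⁻ x : Fin (k + 1) → Vec d, ENNReal.ofReal (Real.exp (∑ i : Fin k, h (x i.castSucc))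
        * ‖x (Fin.last k)‖ ^ 2) ∂(Measure.pi fun _ => isoGaussian c tau)
      ≤ ENNReal.ofReal (Real.exp (k * B) * (‖c‖ ^ 2 + d * tau ^ 2)) := by
  let g : Fin (k + 1) → Vec d → ℝ≥0∞ := Fin.snoc (α := fun _ => Vec d → ℝ≥0∞)
    (fun _ x => ENNReal.ofReal (Real.exp (h x))) (fun x => ENNReal.ofReal (‖x‖ ^ 2))
  have hg : ∀ i, Measurable (g i) := by
    refine Fin.lastCases ?_ fun i => ?_
    · simp only [g, Fin.snoc_last]; fun_prop
    · simp only [g, Fin.snoc_castSucc]; fun_prop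
  have hprod : ∀ x : Fin (k + 1) → Vec d,
      ENNReal.ofReal (Real.exp (∑ i : Fin k, h (x i.castSucc)) * ‖x (Fin.last k)‖ ^ 2)
      = ∏ i, g i (x i) := by
    intro x
    rw [Fin.prod_univ_castSucc]
    simp only [g, Fin.snoc_last, Fin.snoc_castSucc]
    rw [ENNReal.ofReal_mul (Real.exp_pos _).le, Real.exp_sum,
      ENNReal.ofReal_prod_of_nonneg fun _ _ => (Real.exp_pos _).le]
  simp_rw [hprod]
  rw [lintegral_pi_prod _ _ hg, Fin.prod_univ_castSucc]
  simp only [g, Fin.snoc_last, Fin.snoc_castSucc, Finset.prod_const, Finset.card_univ,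
    Fintype.card_fin]
  rw [lintegral_norm_sq_isoGaussian, ENNReal.ofReal_mul (Real.exp_pos _).le, Real.exp_nat_mul,
    ENNReal.ofReal_pow (Real.exp_pos _).le]
  gcongr

/-- The first term comes from prompts whose Gram entries are all within t of their means. The second
is a union bound over d² entries and two signs; keeping ‖x_{k+1}‖² inside the exponential moment
avoids conditioning on the bad event. -/
theorem PretrainModel.iclRisk_bayesPredictor_le {d M : ℕ} (P : PretrainModel d M)
    (muStar : Vec d) {wStar : Vec d} (hw : ‖wStar‖ = 1) (tau : ℝ) :
    ∃ A s₀ : ℝ, 0 < s₀ ∧ ∀ (k : ℕ) (s t : ℝ), 0 ≤ s → s ≤ s₀ → d * t ≤ k * tau ^ 2 →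
      iclRisk muStar wStar tau k (P.bayesPredictor k) ≤
        ENNReal.ofReal (4 * (‖muStar‖ ^ 2 + d * tau ^ 2) *
          (1 / (1 + P.deltaW * (k * tau ^ 2 - d * t)) ^ 2
            + 2 * d ^ 2 * Real.exp (k * (A * s ^ 2) - s * t))) := by
  obtain ⟨A, s₀, hs₀, hA⟩ := lintegral_exp_coord_mul_coord_le muStar tau
  refine ⟨A, s₀, hs₀, fun k s t hs hss hdt => ?_⟩
  set l := k * tau ^ 2 - d * t with hl
  have hl0 : 0 ≤ l := sub_nonneg.2 hdt
  let D : Fin d → Fin d → Vec d → ℝ := fun a b x =>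
    x a * x b - (muStar a * muStar b + if a = b then tau ^ 2 else 0)
  let sg : Bool → ℝ := fun e => if e then 1 else -1
  let T : Fin d × Fin d × Bool → (Fin (k + 1) → Vec d) → ℝ := fun j x =>
    Real.exp (∑ i : Fin k, (sg j.2.2 * s) * D j.1 j.2.1 (x i.castSucc)) * ‖x (Fin.last k)‖ ^ 2
  have hT0 : ∀ j x, 0 ≤ T j x := fun j x => by positivity
  have hpt : ∀ x : Fin (k + 1) → Vec d,
      (P.bayesPredictor k (fun i => (x i.castSucc, inner ℝ (x i.castSucc) wStar), x (Fin.last k))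
        - inner ℝ (x (Fin.last k)) wStar) ^ 2
      ≤ 4 / (1 + P.deltaW * l) ^ 2 * ‖x (Fin.last k)‖ ^ 2
        + ∑ j, 4 * Real.exp (-(s * t)) * T j x := by
    intro x
    by_cases hgood : ∀ a b, |∑ i : Fin k, D a b (x i.castSucc)| ≤ t
    · refine (P.sq_bayesPredictor_sub_le (fun i => x i.castSucc) _ hw hl0
        (sum_inner_sq_ge _ muStar tau t hgood)).trans (le_add_of_nonneg_right ?_)
      exact Finset.sum_nonneg fun j _ => mul_nonneg (by positivity) (hT0 j x)
    · push Not at hgood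
      obtain ⟨a, b, hab⟩ := hgood
      -- On a bad prompt the trivial bound l = 0 is used.
      have hbase := P.sq_bayesPredictor_sub_le (fun i => x i.castSucc) (x (Fin.last k)) hw le_rfl
        (fun v => by rw [zero_mul]; exact Finset.sum_nonneg fun i _ => sq_nonneg _)
      rw [mul_zero, add_zero, one_pow, div_one] at hbase
      refine (hbase.trans ?_).trans (le_add_of_nonneg_left (by positivity))
      obtain ⟨e, he⟩ : ∃ e : Bool, t ≤ sg e * ∑ i : Fin k, D a b (x i.castSucc) := by
        rcases lt_abs.1 hab with h | h
        · exact ⟨true, by simp [sg, h.le]⟩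
        · exact ⟨false, by simpa [sg] using h.le⟩
      have hone : 1 ≤ Real.exp (-(s * t)) *
          Real.exp (∑ i : Fin k, (sg e * s) * D a b (x i.castSucc)) := by
        rw [← Real.exp_add, Real.one_le_exp_iff, ← Finset.mul_sum]
        have := mul_le_mul_of_nonneg_left he hs
        linarith
      refine le_trans ?_ (Finset.single_le_sum (f := fun j => 4 * Real.exp (-(s * t)) * T j x)
        (fun j _ => mul_nonneg (by positivity) (hT0 j x)) (Finset.mem_univ (a, b, e)))
      have := mul_le_mul_of_nonneg_right hone (show 0 ≤ 4 * ‖x (Fin.last k)‖ ^ 2 by positivity)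
      simp only [T]
      linarith
  have hTm : ∀ j, Measurable fun x => ENNReal.ofReal (4 * Real.exp (-(s * t)) * T j x) := by
    intro j
    simp only [T, D]
    fun_prop
  have hTint : ∀ j, ∫⁻ x, ENNReal.ofReal (4 * Real.exp (-(s * t)) * T j x)
      ∂(Measure.pi fun _ => isoGaussian muStar tau)
      ≤ ENNReal.ofReal (4 * (‖muStar‖ ^ 2 + d * tau ^ 2)
        * Real.exp (k * (A * s ^ 2) - s * t)) := by
    intro j
    simp_rw [ENNReal.ofReal_mul (show 0 ≤ 4 * Real.exp (-(s * t)) by positivity)]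
    rw [lintegral_const_mul _ (by simp only [T, D]; fun_prop)]
    have hsg : |sg j.2.2 * s| ≤ s₀ := by
      rw [abs_mul, abs_of_nonneg hs]
      cases j.2.2 <;> simpa [sg] using hss
    have hsq : (sg j.2.2 * s) ^ 2 = s ^ 2 := by
      cases j.2.2 <;> simp [sg]
    have h1 := hA j.1 j.2.1 _ hsg
    rw [hsq] at h1
    have h2 := lintegral_exp_sum_mul_norm_sq_le (h := fun x => (sg j.2.2 * s) * D j.1 j.2.1 x)
      (by simp only [D]; fun_prop) h1 k
    refine (mul_le_mul_right h2 _).trans_eq ?_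
    rw [← ENNReal.ofReal_mul (by positivity)]
    congr 1
    rw [sub_eq_add_neg, Real.exp_add]
    ring
  have hlast : ∫⁻ x : Fin (k + 1) → Vec d,
      ENNReal.ofReal (4 / (1 + P.deltaW * l) ^ 2 * ‖x (Fin.last k)‖ ^ 2)
      ∂(Measure.pi fun _ => isoGaussian muStar tau)
      = ENNReal.ofReal (4 / (1 + P.deltaW * l) ^ 2 * (‖muStar‖ ^ 2 + d * tau ^ 2)) := by
    have hev := measurePreserving_eval (fun _ : Fin (k + 1) => isoGaussian muStar tau) (Fin.last k)
    have := hev.lintegral_comp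
      (f := fun y : Vec d => ENNReal.ofReal (4 / (1 + P.deltaW * l) ^ 2 * ‖y‖ ^ 2)) (by fun_prop)
    simp only [Function.eval] at this
    rw [this]
    simp_rw [ENNReal.ofReal_mul (show 0 ≤ 4 / (1 + P.deltaW * l) ^ 2 by positivity)]
    rw [lintegral_const_mul _ (by fun_prop), lintegral_norm_sq_isoGaussian]
  unfold iclRisk
  calc _ ≤ ∫⁻ x : Fin (k + 1) → Vec d,
        (ENNReal.ofReal (4 / (1 + P.deltaW * l) ^ 2 * ‖x (Fin.last k)‖ ^ 2)
        + ∑ j, ENNReal.ofReal (4 * Real.exp (-(s * t)) * T j x))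
        ∂(Measure.pi fun _ => isoGaussian muStar tau) := by
        refine lintegral_mono fun x => (ENNReal.ofReal_le_ofReal (hpt x)).trans ?_
        refine ENNReal.ofReal_add_le.trans ?_
        rw [ENNReal.ofReal_sum_of_nonneg fun j _ => mul_nonneg (by positivity) (hT0 j x)]
    _ ≤ ENNReal.ofReal (4 / (1 + P.deltaW * l) ^ 2 * (‖muStar‖ ^ 2 + d * tau ^ 2))
        + ∑ _j : Fin d × Fin d × Bool, ENNReal.ofReal (4 * (‖muStar‖ ^ 2 + d * tau ^ 2)
        * Real.exp (k * (A * s ^ 2) - s * t)) := by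
        rw [lintegral_add_left (by fun_prop), lintegral_finsetSum _ fun j _ => hTm j, hlast]
        gcongr with j
        exact hTint j
    _ = _ := by
        rw [← ENNReal.ofReal_sum_of_nonneg fun j _ => by positivity,
          ← ENNReal.ofReal_add (by positivity) (Finset.sum_nonneg fun j _ => by positivity)]
        congr 1
        simp
        ring

/-! ### Choice of parameters and asymptotics -/

/-- Because (1 + 6r)(1 - r)² - 1 = r(1 - 2r)(4 - 3r). -/
theorem one_div_sq_one_sub_le {r : ℝ} (h0 : 0 ≤ r) (h1 : r ≤ 1 / 2) :
    1 / (1 - r) ^ 2 ≤ 1 + 6 * r := by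
  rw [div_le_iff₀ (by nlinarith)]
  nlinarith [mul_nonneg h0 (mul_nonneg (sub_nonneg.2 h1) (show 0 ≤ 4 - 3 * r by linarith))]

open Filter Topology in
theorem eventually_rpow_estimates {η : ℝ} (h0 : 0 < η) (h1 : η ≤ 1 / 4) {ε s₀ : ℝ} (hε : 0 < ε)
    (hs₀ : 0 < s₀) :
    ∀ᶠ k : ℕ in atTop, 1 ≤ k ∧ (k : ℝ) ^ (η - 1 / 2) ≤ ε ∧ (k : ℝ) ^ (-(1 / 2) : ℝ) ≤ s₀ ∧
      Real.exp (-(k : ℝ) ^ η) ≤ (k : ℝ) ^ (η - 5 / 2) := by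
  have hcast := tendsto_natCast_atTop_atTop (R := ℝ)
  have e1 : ∀ᶠ k : ℕ in atTop, (k : ℝ) ^ (η - 1 / 2) < ε := by
    have := (tendsto_rpow_neg_atTop (show 0 < 1 / 2 - η by linarith)).comp hcast
    simp only [neg_sub] at this
    exact this.eventually (gt_mem_nhds hε)
  have e2 : ∀ᶠ k : ℕ in atTop, (k : ℝ) ^ (-(1 / 2) : ℝ) < s₀ :=
    ((tendsto_rpow_neg_atTop (show (0 : ℝ) < 1 / 2 by norm_num)).comp hcast).eventually
      (gt_mem_nhds hs₀)
  have e3 : ∀ᶠ k : ℕ in atTop,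
      ((k : ℝ) ^ η) ^ ((5 / 2) / η) * Real.exp (-1 * (k : ℝ) ^ η) < 1 :=
    -- The exponent (5/2)/η turns k^η into k^(5/2).
    ((tendsto_rpow_mul_exp_neg_mul_atTop_nhds_zero ((5 / 2) / η) 1 one_pos).comp
      ((tendsto_rpow_atTop h0).comp hcast)).eventually (gt_mem_nhds one_pos)
  filter_upwards [e1, e2, e3, eventually_ge_atTop 1] with k a1 a2 a3 hk
  refine ⟨hk, a1.le, a2.le, ?_⟩
  have hk1 : (1 : ℝ) ≤ k := by exact_mod_cast hk
  have hk0 : (0 : ℝ) < k := by linarith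
  rw [← Real.rpow_mul hk0.le, mul_div_cancel₀ _ h0.ne', neg_one_mul] at a3
  have hp : (0 : ℝ) < (k : ℝ) ^ (5 / 2 : ℝ) := Real.rpow_pos_of_pos hk0 _
  have h2 : Real.exp (-(k : ℝ) ^ η) ≤ (k : ℝ) ^ (-(5 / 2) : ℝ) := by
    rw [Real.rpow_neg hk0.le, ← one_div, le_div_iff₀ hp, mul_comm]
    exact a3.le
  exact h2.trans (Real.rpow_le_rpow_of_exponent_le hk1 (by linarith))

theorem PretrainModel.iclRisk_bayesPredictor_lt {d M : ℕ} (P : PretrainModel d M)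
    {muStar wStar : Vec d} (hmu : ‖muStar‖ = 1) (hw : ‖wStar‖ = 1) {tau : ℝ} (htau : 0 < tau)
    {δ : ℝ} (hδ : 0 < δ) : ∃ (C : ℝ) (k₀ : ℕ), ∀ k : ℕ, k₀ ≤ k →
      iclRisk muStar wStar tau k (P.bayesPredictor k) <
        ENNReal.ofReal (4 * (1 + d * tau ^ 2) / (tau ^ 4 * P.deltaW ^ 2 * (k : ℝ) ^ 2)
          + C * (k : ℝ) ^ (δ - 5 / 2)) := by
  have hW : 0 < P.deltaW := by
    have := P.sigmaW_pos
    have := P.sigmaY_pos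
    unfold deltaW
    positivity
  obtain ⟨A, s₀, hs₀, hA⟩ := P.iclRisk_bayesPredictor_le muStar hw tau
  rw [hmu, one_pow] at hA
  -- Shrinking δ only strengthens the bound, and η < 1/2 keeps the deviation k^(η+1/2) of lower
  -- order than k.
  set η := min δ (1 / 4) with hη
  have hη0 : 0 < η := lt_min hδ (by norm_num)
  set G := 4 * (1 + d * tau ^ 2) with hG
  have hG0 : 0 < G := by positivity
  set C₁ := 6 * (d / tau ^ 2) / (tau ^ 4 * P.deltaW ^ 2) with hC₁
  have hC₁0 : 0 ≤ C₁ := by positivity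
  -- The threshold τ²/(2(d+1)) forces r ≤ 1/2 below; d + 1 also covers d = 0.
  obtain ⟨k₀, hk₀⟩ := Filter.eventually_atTop.1 (eventually_rpow_estimates hη0 (min_le_right _ _)
    (show 0 < tau ^ 2 / (2 * (d + 1)) by positivity) hs₀)
  -- `C₁` pays for replacing l by kτ², the exponential term for the bad prompts, and the final 1
  -- makes the inequality strict.
  refine ⟨G * (C₁ + 2 * d ^ 2 * Real.exp A) + 1, k₀, fun k hk => ?_⟩
  obtain ⟨h1, h2, h3, h4⟩ := hk₀ k hk
  have hk1 : (1 : ℝ) ≤ k := by exact_mod_cast h1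
  have hk0 : (0 : ℝ) < k := by linarith
  set r := d / tau ^ 2 * (k : ℝ) ^ (η - 1 / 2) with hr
  have hr0 : 0 ≤ r := by positivity
  have hr1 : r ≤ 1 / 2 := by
    calc r ≤ d / tau ^ 2 * (tau ^ 2 / (2 * (d + 1))) :=
          mul_le_mul_of_nonneg_left h2 (by positivity)
      _ = d / (d + 1) / 2 := by field_simp
      _ ≤ 1 / 2 := by
        gcongr
        rw [div_le_one (by positivity)]
        linarith
  have hdt : d * (k : ℝ) ^ (η + 1 / 2) = k * tau ^ 2 * r := by
    rw [hr, show η + 1 / 2 = (η - 1 / 2) + 1 by ring, Real.rpow_add_one hk0.ne']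
    field_simp
  have hs0 : (0 : ℝ) ≤ (k : ℝ) ^ (-(1 / 2) : ℝ) := by positivity
  have hkt : 0 < k * tau ^ 2 := by positivity
  -- With s = k^(-1/2) and t = k^(η+1/2) the Chernoff exponent k·A·s² - s·t becomes A - k^η.
  have hb := hA k _ ((k : ℝ) ^ (η + 1 / 2)) hs0 h3 (by rw [hdt]; nlinarith)
  have hsq : (k : ℝ) * (A * ((k : ℝ) ^ (-(1 / 2) : ℝ)) ^ 2) = A := by
    rw [← Real.rpow_natCast, ← Real.rpow_mul hk0.le]
    norm_num
    rw [Real.rpow_neg_one]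
    field_simp
  have hst : (k : ℝ) ^ (-(1 / 2) : ℝ) * (k : ℝ) ^ (η + 1 / 2) = (k : ℝ) ^ η := by
    rw [← Real.rpow_add hk0]; congr 1; ring
  rw [hsq, hst, hdt] at hb
  have hpow : (k : ℝ) ^ (η - 1 / 2) / (k : ℝ) ^ 2 = (k : ℝ) ^ (η - 5 / 2) := by
    rw [← Real.rpow_natCast, ← Real.rpow_sub hk0]; congr 1; norm_num; ring
  have hfirst : 1 / (1 + P.deltaW * (k * tau ^ 2 - k * tau ^ 2 * r)) ^ 2
      ≤ 1 / (tau ^ 4 * P.deltaW ^ 2 * (k : ℝ) ^ 2) + C₁ * (k : ℝ) ^ (η - 5 / 2) := by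
    have hpos : 0 < P.deltaW * (k * tau ^ 2 * (1 - r)) := by
      have : 0 < 1 - r := by linarith
      positivity
    calc 1 / (1 + P.deltaW * (k * tau ^ 2 - k * tau ^ 2 * r)) ^ 2
        ≤ 1 / (P.deltaW * (k * tau ^ 2 * (1 - r))) ^ 2 := by
          refine one_div_le_one_div_of_le (by positivity) (pow_le_pow_left₀ hpos.le ?_ 2)
          linarith
      _ = 1 / (tau ^ 4 * P.deltaW ^ 2 * (k : ℝ) ^ 2) * (1 / (1 - r) ^ 2) := by
          rw [div_mul_div_comm]
          congr 1 <;> ring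
      _ ≤ 1 / (tau ^ 4 * P.deltaW ^ 2 * (k : ℝ) ^ 2) * (1 + 6 * r) := by
          gcongr
          exact one_div_sq_one_sub_le hr0 hr1
      _ = _ := by
          rw [hC₁, hr, ← hpow]
          field_simp
  have hsecond : Real.exp (A - (k : ℝ) ^ η) ≤ Real.exp A * (k : ℝ) ^ (η - 5 / 2) := by
    rw [sub_eq_add_neg, Real.exp_add]
    gcongr
  have hle : (k : ℝ) ^ (η - 5 / 2) ≤ (k : ℝ) ^ (δ - 5 / 2) :=
    Real.rpow_le_rpow_of_exponent_le hk1 (by linarith [min_le_left δ (1 / 4)])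
  have hpδ : 0 < (k : ℝ) ^ (δ - 5 / 2) := Real.rpow_pos_of_pos hk0 _
  refine hb.trans_lt ((ENNReal.ofReal_lt_ofReal_iff (by positivity)).2 ?_)
  calc G * (1 / (1 + P.deltaW * (k * tau ^ 2 - k * tau ^ 2 * r)) ^ 2
        + 2 * d ^ 2 * Real.exp (A - (k : ℝ) ^ η))
      ≤ G * ((1 / (tau ^ 4 * P.deltaW ^ 2 * (k : ℝ) ^ 2) + C₁ * (k : ℝ) ^ (η - 5 / 2))
        + 2 * d ^ 2 * (Real.exp A * (k : ℝ) ^ (η - 5 / 2))) := by gcongr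
    _ = G / (tau ^ 4 * P.deltaW ^ 2 * (k : ℝ) ^ 2)
        + G * (C₁ + 2 * d ^ 2 * Real.exp A) * (k : ℝ) ^ (η - 5 / 2) := by ring
    _ ≤ G / (tau ^ 4 * P.deltaW ^ 2 * (k : ℝ) ^ 2)
        + G * (C₁ + 2 * d ^ 2 * Real.exp A) * (k : ℝ) ^ (δ - 5 / 2) := by gcongr
    _ < _ := by linarith

end

theorem theorem4 {d M : ℕ} (P : PretrainModel d M) (muStar wStar : Vec d)
    (hmu : ‖muStar‖ = 1) (hw : ‖wStar‖ = 1) (tau : ℝ) (htau : 0 < tau) :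
    -- the Bayes predictor is continuous and attains the optimal pretraining risk
    (∀ k, Continuous (P.bayesPredictor k)) ∧
    (∀ K : ℕ, P.IsOptimal K (fun k => P.bayesPredictor k)) ∧
    -- the risk bound for every continuous predictor attaining the optimal pretraining risk
    ∀ δ : ℝ, 0 < δ → ∃ (C : ℝ) (k₀ : ℕ), ∀ (K : ℕ) (k : Fin K), k₀ ≤ (k : ℕ) →
      ∀ F : Predictor d K, (∀ j, Continuous (F j)) → P.IsOptimal K F →
        iclRisk muStar wStar tau k (F k) <
          ENNReal.ofReal
            (4 * (1 + d * tau ^ 2) / (tau ^ 4 * P.deltaW ^ 2 * ((k : ℕ) : ℝ) ^ 2)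
              + C * ((k : ℕ) : ℝ) ^ (δ - 5 / 2)) := by
  refine ⟨P.continuous_bayesPredictor, P.isOptimal_bayesPredictor, fun δ hδ => ?_⟩
  obtain ⟨C, k₀, h⟩ := P.iclRisk_bayesPredictor_lt hmu hw htau hδ
  refine ⟨C, k₀, fun K k hk F hc hF => ?_⟩
  rw [P.eq_bayesPredictor_of_isOptimal hc hF k]
  exact h k hk
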